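/- **Setting.** Consider the call-by-value $\lambda$-calculus with callcc ($\mathcal K$) and abort ($\mathcal A$), modulo $\alpha$-conversion, extended with context variables $c$ (from an infinite set, never bound): terms $t,s ::= x \mid \lambda x.t \mid t\,s \mid \mathcal K \mid \mathcal A\,p$, values $v,w ::= x\mid\lambda x.t\mid\mathcal K$, programs $p,q ::= t \mid c[t]$, evaluation contexts $E ::= [\,]\mid E\,t\mid v\,E$, program contexts $F ::= E\mid c[E]$. Reduction on programs is $F[(\lambda x.t)\,v]\to F[t[v/x]]$, $F[\mathcal K\,v]\to F[v\,(\lambda y.\mathcal A\,F[y])]$ ($y$ not free in $F$), $F[\mathcal A\,p]\to p$. We write $\to^*$ for its reflexive transitive closure and $p\Downarrow q$ if $p\to^* q$ and $q$ does not reduce. Context substitution $p[F/c]$ replaces every subprogram $c[t]$ by $F[t[F/c]]$. For a relation $R$ on programs, let $t\,R^{t}\,s$ if $c[t]\,R\,c[s]$ for some fresh $c$; $v\,R^{v}\,w$ if $(v\,x)\,R^{t}\,(w\,x)$ for some fresh $x$; $F\,R^{c}\,F'$ if $F[x]\,R\,F'[x]$ for some fresh $x$; and $F[x\,v]\,R^{o}\,F'[x\,w]$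 if $F\,R^{c}\,F'$ and $v\,R^{v}\,w$. $R$ *diacritically progresses* to $S,T$, written $R\rightsquigarrow S,T$, if $R\subseteq S\subseteq T$ and $p\,R\,q$ implies: if $p\to p'$, then $q\to^*q'$ with $p'\,T\,q'$ for some $q'$; if $p$ is a value, then $q\Downarrow w$ for some value $w$; if $p=F[x\,v]$, then $q\Downarrow F'[x\,w]$ with $p\,T^{o}\,F'[x\,w]$ for some $F',w$; if $p=c[v]$, then $q\Downarrow c[w]$ with $v\,S^{v}\,w$ for some $w$; and the converse conditions on $q$. A *normal-form bisimulation* is an $R$ with $R\rightsquigarrow R,R$; *bisimilarity* $\approx$ is the union of all of them. For functions $f,g,h$ on relations, let $\hat f = f\cup\mathrm{id}$ and $f^\omega=\bigcup_{n\in\mathbb N} f^n$; $f$ *evolves* to $g,h$ if $R\rightsquigarrow R,T$ implies $f(R)\rightsquigarrow g(R),h(T)$, and *strongly evolves* to $g,h$ if $R\rightsquigarrow S,T$ implies $f(R)\rightsquigarrow g(S),h(T)$. A function $f$ is *continuous* if $f(R)$ is the union of the $f(R_0)$ over the finite $R_0\subseteq R$ for all $R$. A set of functions is also used as the function that is their pointwise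 union. A set $\mathcal F$ of continuous functions is *diacritically compatible* if some $\mathcal S\subseteq\mathcal F$ satisfies: every $f\in\mathcal S$ strongly evolves to $\hat{\mathcal S}^\omega,\hat{\mathcal F}^\omega$, and every $f\in\mathcal F$ evolves to $\hat{\mathcal S}^\omega\circ\hat{\mathcal F}\circ\hat{\mathcal S}^\omega,\hat{\mathcal F}^\omega$; the largest such $\mathcal S$ is $\mathsf{strong}(\mathcal F)$. Let $\mathcal F=\{\mathsf{refl},\mathsf{result},\mathsf{abort},\mathsf{lam},\mathsf{subst}_v,\mathsf{subst}_c,\mathsf{red}\}$, where, for each $R$, the relations are given by exactly these rules: $p\;\mathsf{refl}(R)\;p$; $v\;\mathsf{result}(R)\;w$ for all values $v,w$; $c[\mathcal A\,p]\;\mathsf{abort}(R)\;c[\mathcal A\,q]$ if $p\,R\,q$; $c[\lambda x.t]\;\mathsf{lam}(R)\;c[\lambda x.s]$ if $t\,R^{t}\,s$; $p[v/x]\;\mathsf{subst}_v(R)\;q[w/x]$ if $p\,R\,q$ and $v\,R^{v}\,w$; $p[F/c]\;\mathsf{subst}_c(R)\;q[F'/c]$ if $p\,R\,q$ and $F\,R^{c}\,F'$;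 $p\;\mathsf{red}(R)\;q$ if $p\to^*p'$, $q\to^*q'$ and $p'\,R\,q'$ for some $p',q'$. **Theorem.** The set $\mathcal F$ is diacritically compatible, with $\mathsf{strong}(\mathcal F)=\mathcal F\setminus\{\mathsf{subst}_c\}$. Moreover the induced bisimilarity on terms $\approx^{t}$ is a congruence: it is an equivalence relation, and $t\approx^{t}s$ implies $C[t]\approx^{t}C[s]$ for every (possibly capturing) term context $C$ of the extended calculus. -/

import Mathlib

namespace CallccNF

/-! ## Terms, programs and contexts -/

/-- Term variables. -/
abbrev Var := ℕ

/-- Context variables; no construct binds them. -/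
abbrev CVar := ℕ

/-- Terms `t ::= x | λ t | t s | callcc | abort p`, modulo α-conversion: variables are de Bruijn
indices, and the free variable named `x` is the index `x` outside every binder (hence `x + k` below
`k` binders). A program `p ::= t | κ[t]` is a term with an optional head context variable,
so `abort none t` is `abort t` and `abort (some κ) t` is `abort κ[t]`. -/
inductive Tm : Type
  | var (x : Var) : Tm
  | lam (t : Tm) : Tm
  | app (t s : Tm) : Tm
  | callcc : Tm
  | abort (h : Option CVar) (t : Tm) : Tm

/-- Programs `p ::= t | κ[t]`: the head is `none`, respectively `some κ`. -/
@[ext]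
structure Prog : Type where
  head : Option CVar
  body : Tm

/-- A term seen as a program. -/
def Prog.ofTm (t : Tm) : Prog := ⟨none, t⟩

/-- The program `κ[t]`. -/
def Prog.inCtx (c : CVar) (t : Tm) : Prog := ⟨some c, t⟩

/-- The term `abort p`. -/
def Prog.abort (p : Prog) : Tm := Tm.abort p.head p.body

/-- Values `v ::= x | λ t | callcc`. -/
def Tm.IsVal : Tm → Prop
  | .var _ => True
  | .lam _ => True
  | .app _ _ => False
  | .callcc => True
  | .abort _ _ => False

/-- A renaming below a binder. -/
def upRen (r : Var → Var) : Var → Var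
  | 0 => 0
  | x + 1 => r x + 1

/-- Renaming of the free variables. -/
def Tm.rename (r : Var → Var) : Tm → Tm
  | .var x => .var (r x)
  | .lam t => .lam (t.rename (upRen r))
  | .app t s => .app (t.rename r) (s.rename r)
  | .callcc => .callcc
  | .abort h t => .abort h (t.rename r)

theorem Tm.IsVal.rename {v : Tm} (hv : v.IsVal) (r : Var → Var) : (v.rename r).IsVal := by
  cases v <;> simp_all [Tm.IsVal, Tm.rename]

/-- A simultaneous substitution below a binder. -/
def upSub (σ : Var → Tm) : Var → Tm
  | 0 => .var 0
  | x + 1 => (σ x).rename Nat.succ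

/-- Capture-avoiding simultaneous substitution. -/
def Tm.inst (σ : Var → Tm) : Tm → Tm
  | .var x => σ x
  | .lam t => .lam (t.inst (upSub σ))
  | .app t s => .app (t.inst σ) (s.inst σ)
  | .callcc => .callcc
  | .abort h t => .abort h (t.inst σ)

/-- `t[v/x]`: substitution of `v` for the free variable `x`. -/
def Tm.subst (t : Tm) (x : Var) (v : Tm) : Tm :=
  t.inst (fun y => if y = x then v else .var y)

/-- `p[v/x]`. -/
def Prog.subst (p : Prog) (x : Var) (v : Tm) : Prog := ⟨p.head, p.body.subst x v⟩

/-- The substitution of `v` for the bound variable of an abstraction, applied to its body. -/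
def Tm.beta (t : Tm) (v : Tm) : Tm :=
  t.inst (fun y => match y with
    | 0 => v
    | x + 1 => .var x)

/-- `λx.t` for a named variable `x`, which gets bound. -/
def Tm.abs (x : Var) (t : Tm) : Tm :=
  .lam (t.rename (fun y => if y = x then 0 else y + 1))

/-- Free variables of a term. -/
def Tm.fv : Tm → Set Var
  | .var x => {x}
  | .lam t => {x | x + 1 ∈ t.fv}
  | .app t s => t.fv ∪ s.fv
  | .callcc => ∅
  | .abort _ t => t.fv

/-- Context variables of a term. -/
def Tm.fk : Tm → Set CVar
  | .var _ => ∅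
  | .lam t => t.fk
  | .app t s => t.fk ∪ s.fk
  | .callcc => ∅
  | .abort h t => {c | h = some c} ∪ t.fk

/-- Evaluation contexts `E ::= [] | E t | v E`. -/
inductive ECtx : Type
  | hole : ECtx
  | appL (E : ECtx) (t : Tm) : ECtx
  | appR (v : Tm) (hv : v.IsVal) (E : ECtx) : ECtx

def ECtx.plug : ECtx → Tm → Tm
  | .hole, t => t
  | .appL E s, t => .app (E.plug t) s
  | .appR v _ E, t => .app v (E.plug t)

def ECtx.rename (r : Var → Var) : ECtx → ECtx
  | .hole => .hole
  | .appL E t => .appL (E.rename r) (t.rename r)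
  | .appR v hv E => .appR (v.rename r) (hv.rename r) (E.rename r)

def ECtx.fv : ECtx → Set Var
  | .hole => ∅
  | .appL E t => E.fv ∪ t.fv
  | .appR v _ E => v.fv ∪ E.fv

/-- Program contexts `F ::= E | κ[E]`. -/
structure PCtx : Type where
  head : Option CVar
  ectx : ECtx

def PCtx.plug (F : PCtx) (t : Tm) : Prog := ⟨F.head, F.ectx.plug t⟩

def PCtx.rename (r : Var → Var) (F : PCtx) : PCtx := ⟨F.head, F.ectx.rename r⟩

def PCtx.fv (F : PCtx) : Set Var := F.ectx.fv

/-- `λy. abort F[y]` with `y ∉ fv(F)`: the reification of a program context. -/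
def PCtx.reify (F : PCtx) : Tm :=
  .lam ((F.rename Nat.succ).plug (.var 0)).abort

/-- Context substitution `t[F/c]` on terms: every sub-program `c[s]` becomes `F[s[F/c]]`. -/
def Tm.substc (c : CVar) : PCtx → Tm → Tm
  | _, .var x => .var x
  | F, .lam t => .lam (Tm.substc c (F.rename Nat.succ) t)
  | F, .app t s => .app (Tm.substc c F t) (Tm.substc c F s)
  | _, .callcc => .callcc
  | F, .abort h t =>
      if h = some c then (F.plug (Tm.substc c F t)).abort else .abort h (Tm.substc c F t)

/-- Context substitution `p[F/c]` on programs. -/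
def Prog.substc (p : Prog) (c : CVar) (F : PCtx) : Prog :=
  if p.head = some c then F.plug (p.body.substc c F) else ⟨p.head, p.body.substc c F⟩

/-! ## Reduction -/

/-- Call-by-value reduction of programs. -/
inductive Red : Prog → Prog → Prop
  | beta (F : PCtx) (t v : Tm) (hv : v.IsVal) :
      Red (F.plug (.app (.lam t) v)) (F.plug (t.beta v))
  | callcc (F : PCtx) (v : Tm) (hv : v.IsVal) :
      Red (F.plug (.app .callcc v)) (F.plug (.app v F.reify))
  | abort (F : PCtx) (p : Prog) :
      Red (F.plug p.abort) p

/-- Reflexive and transitive closure of reduction. -/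
def Reds : Prog → Prog → Prop := Relation.ReflTransGen Red

/-- `p` evaluates to `q`: it reduces to `q`, and `q` does not reduce. -/
def Eval (p q : Prog) : Prop := Reds p q ∧ ∀ r, ¬ Red q r

/-! ## Normal-form bisimulation -/

/-- Relations on programs. -/
abbrev PRel := Set (Prog × Prog)

/-- Relation on terms tested in a fresh abstract context. -/
def TestTm (R : PRel) (t s : Tm) : Prop :=
  ∃ c : CVar, c ∉ t.fk ∧ c ∉ s.fk ∧ (Prog.inCtx c t, Prog.inCtx c s) ∈ R

/-- Relation on values tested with a fresh variable. -/
def TestVal (R : PRel) (v w : Tm) : Prop :=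
  ∃ x : Var, x ∉ v.fv ∧ x ∉ w.fv ∧ TestTm R (.app v (.var x)) (.app w (.var x))

/-- Relation on program contexts tested with a fresh variable. -/
def TestCtx (R : PRel) (F F' : PCtx) : Prop :=
  ∃ x : Var, x ∉ F.fv ∧ x ∉ F'.fv ∧ (F.plug (.var x), F'.plug (.var x)) ∈ R

/-- Relation on open stuck programs `F[x v]`. -/
def TestOpen (R : PRel) (p q : Prog) : Prop :=
  ∃ (F F' : PCtx) (x : Var) (v w : Tm), v.IsVal ∧ w.IsVal ∧
    p = F.plug (.app (.var x) v) ∧ q = F'.plug (.app (.var x) w) ∧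
    TestCtx R F F' ∧ TestVal R v w

/-- Diacritical progress of `R` to `S` (passive clause) and `T` (active clauses). -/
structure Progress (R S T : PRel) : Prop where
  sub_passive : R ⊆ S
  passive_sub : S ⊆ T
  red : ∀ p q, (p, q) ∈ R → ∀ p', Red p p' → ∃ q', Reds q q' ∧ (p', q') ∈ T
  val : ∀ p q, (p, q) ∈ R → ∀ v, v.IsVal → p = Prog.ofTm v →
    ∃ w, w.IsVal ∧ Eval q (Prog.ofTm w)
  stuck : ∀ p q, (p, q) ∈ R → ∀ F x v, v.IsVal → p = PCtx.plug F (.app (.var x) v) →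
    ∃ F' w, w.IsVal ∧ Eval q (PCtx.plug F' (.app (.var x) w)) ∧
      TestOpen T p (PCtx.plug F' (.app (.var x) w))
  ctxVal : ∀ p q, (p, q) ∈ R → ∀ c v, v.IsVal → p = Prog.inCtx c v →
    ∃ w, w.IsVal ∧ Eval q (Prog.inCtx c w) ∧ TestVal S v w
  red_conv : ∀ p q, (p, q) ∈ R → ∀ q', Red q q' → ∃ p', Reds p p' ∧ (p', q') ∈ T
  val_conv : ∀ p q, (p, q) ∈ R → ∀ w, w.IsVal → q = Prog.ofTm w →
    ∃ v, v.IsVal ∧ Eval p (Prog.ofTm v)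
  stuck_conv : ∀ p q, (p, q) ∈ R → ∀ F' x w, w.IsVal → q = PCtx.plug F' (.app (.var x) w) →
    ∃ F v, v.IsVal ∧ Eval p (PCtx.plug F (.app (.var x) v)) ∧
      TestOpen T (PCtx.plug F (.app (.var x) v)) q
  ctxVal_conv : ∀ p q, (p, q) ∈ R → ∀ c w, w.IsVal → q = Prog.inCtx c w →
    ∃ v, v.IsVal ∧ Eval p (Prog.inCtx c v) ∧ TestVal S v w

/-- Normal-form bisimulations. -/
def IsBisim (R : PRel) : Prop := Progress R R R

/-- Normal-form bisimilarity: the union of all normal-form bisimulations. -/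
def bisim : PRel := ⋃₀ {R | IsBisim R}

/-! ## Functions on relations and diacritical compatibility -/

/-- Functions on relations. -/
abbrev RelFun := PRel → PRel

/-- `f` is determined by its image on finite subsets. -/
def RelFun.Continuous (f : RelFun) : Prop :=
  ∀ R : PRel, f R = ⋃ S ∈ {S : PRel | S.Finite ∧ S ⊆ R}, f S

/-- The function `⋃_{f ∈ 𝓕} f` of a set of functions. -/
def famFun (𝓕 : Set RelFun) : RelFun := fun R => ⋃ f ∈ 𝓕, f R

/-- `f ∪ id`. -/
def RelFun.hat (f : RelFun) : RelFun := fun R => f R ∪ R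

/-- `f^ω`, the union of all iterates `f^n`, `n ∈ ℕ`. -/
def RelFun.omega (f : RelFun) : RelFun := fun R => ⋃ n : ℕ, (f^[n]) R

/-- Evolution `f ⇝ g, h`. -/
def Evolves (f g h : RelFun) : Prop :=
  ∀ R T : PRel, Progress R R T → Progress (f R) (g R) (h T)

/-- Strong evolution `f ⇝ₛ g, h`. -/
def StronglyEvolves (f g h : RelFun) : Prop :=
  ∀ R S T : PRel, Progress R S T → Progress (f R) (g S) (h T)

/-- The conditions on a subset `𝓢` of `𝓕` in the definition of diacritical compatibility. -/
structure IsStrongPart (𝓕 𝓢 : Set RelFun) : Prop where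
  subset : 𝓢 ⊆ 𝓕
  strong : ∀ f ∈ 𝓢,
    StronglyEvolves f (famFun 𝓢).hat.omega (famFun 𝓕).hat.omega
  regular : ∀ f ∈ 𝓕,
    Evolves f ((famFun 𝓢).hat.omega ∘ (famFun 𝓕).hat ∘ (famFun 𝓢).hat.omega)
      (famFun 𝓕).hat.omega

/-- Diacritically compatible sets of (continuous) functions. -/
def DiacriticallyCompatible (𝓕 : Set RelFun) : Prop :=
  (∀ f ∈ 𝓕, RelFun.Continuous f) ∧ ∃ 𝓢, IsStrongPart 𝓕 𝓢

/-! ## The up-to techniques -/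

/-- `p refl(R) p`. -/
def utRefl : RelFun := fun _ => {pq | ∃ p : Prog, pq = (p, p)}

/-- `v result(R) w`. -/
def utResult : RelFun := fun _ =>
  {pq | ∃ v w : Tm, v.IsVal ∧ w.IsVal ∧ pq = (Prog.ofTm v, Prog.ofTm w)}

/-- `κ[abort p] abort(R) κ[abort q]` if `p R q`. -/
def utAbort : RelFun := fun R =>
  {pq | ∃ (c : CVar) (p q : Prog), (p, q) ∈ R ∧
    pq = (Prog.inCtx c p.abort, Prog.inCtx c q.abort)}

/-- `κ[λx.t] lam(R) κ[λx.s]` if `t` and `s` are related in a fresh abstract context. -/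
def utLam : RelFun := fun R =>
  {pq | ∃ (c : CVar) (x : Var) (t s : Tm), TestTm R t s ∧
    pq = (Prog.inCtx c (Tm.abs x t), Prog.inCtx c (Tm.abs x s))}

/-- `p[v/x] subst_v(R) q[w/x]` if `p R q` and `v`, `w` are related as values. -/
def utSubstV : RelFun := fun R =>
  {pq | ∃ (p q : Prog) (x : Var) (v w : Tm), (p, q) ∈ R ∧ v.IsVal ∧ w.IsVal ∧ TestVal R v w ∧
    pq = (p.subst x v, q.subst x w)}

/-- `p[F/c] subst_c(R) q[F'/c]` if `p R q` and `F`, `F'` are related as program contexts. -/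
def utSubstC : RelFun := fun R =>
  {pq | ∃ (p q : Prog) (c : CVar) (F F' : PCtx), (p, q) ∈ R ∧ TestCtx R F F' ∧
    pq = (p.substc c F, q.substc c F')}

/-- `p red(R) q` if `p` and `q` reduce to programs related by `R`. -/
def utRed : RelFun := fun R =>
  {pq | ∃ p' q' : Prog, Reds pq.1 p' ∧ Reds pq.2 q' ∧ (p', q') ∈ R}

/-- The set of all techniques. -/
def techniques : Set RelFun :=
  {utRefl, utResult, utAbort, utLam, utSubstV, utSubstC, utRed}

/-! ## Congruence -/

/-- Contexts `C`: terms with one hole for a term. -/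
inductive TCtx : Type
  | hole : TCtx
  | lam (x : Var) (C : TCtx) : TCtx
  | appL (C : TCtx) (t : Tm) : TCtx
  | appR (t : Tm) (C : TCtx) : TCtx
  | abort (h : Option CVar) (C : TCtx) : TCtx

/-- `C[t]`; the binders of `C` may capture variables of `t`. -/
def TCtx.plug : TCtx → Tm → Tm
  | .hole, t => t
  | .lam x C, t => Tm.abs x (C.plug t)
  | .appL C s, t => .app (C.plug t) s
  | .appR s C, t => .app s (C.plug t)
  | .abort h C, t => .abort h (C.plug t)

/-- Congruences on terms: equivalence relations preserved by all contexts. -/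
def IsCongruence (r : Tm → Tm → Prop) : Prop :=
  Equivalence r ∧ ∀ (C : TCtx) (t s : Tm), r t s → r (C.plug t) (C.plug s)

end CallccNF

/-!
# Up-to techniques for normal-form bisimilarity in the λ-calculus with callcc and abort

Reduction is deterministic, and each program is exactly one of: a value, a value in a context
variable, open stuck, or reducible (`Prog.classify`). Progress can therefore be read as an
inductive predicate `Matches` on each pair, whose constructors list what the right program does for
each shape of the left one; the converse clauses follow by symmetry of the techniques.

The heart of the proof is the behaviour of `Matches` under substitution. All shapes are preserved,
except that replacing `x` by a value wakes up `F[x a]`, and replacing `c` by a context wakes up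
`c[a]` (`Matches.subst`, `Matches.substc`). The first case is `Progress.matches_app`: an application
`G[v a]` is obtained by substitution from the test `d[v y]` of `v`, and since this test is never
passive, one step of it lands in the relation of active clauses, where all techniques are allowed.
The second case instantiates the test `F[y]` of the contexts with the value `a`. If `F[y]` is itself
passive, the values it tests are related by one substitution of contexts followed by strong
techniques. Hence `subst_c` evolves regularly (`evolves_substC`) while the other techniques evolve
strongly (`stronglyEvolves_of_mem`).

Tests use some fresh variable and some fresh context variable. Renaming the context variable of
a test on values must not cost a use of `subst_c`; it is done by substituting the values for `z` in
the reflexive pair `F[z a]` (`ClosedUnder.plug_app_mem`).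

`subst_c` cannot be strong: after a passive pair `c[x₁]`, `c[x₂]`, the context `c[[] x₃]` exposes
`x₁` and `x₂` at once (`not_stronglyEvolves_substC`). Finally, techniques of a compatible family
preserve bisimilarity (`IsStrongPart.closedUnder_bisim`), from which transitivity and closure
under term contexts follow by suitable substitutions.
-/

namespace CallccNF

/-! ### Substitution calculus -/

theorem upRen_comp (r r' : Var → Var) : upRen r' ∘ upRen r = upRen (r' ∘ r) := by
  funext x; cases x <;> rfl

theorem Tm.rename_rename (t : Tm) (r r' : Var → Var) :
    (t.rename r).rename r' = t.rename (r' ∘ r) := by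
  induction t generalizing r r' <;> simp_all [Tm.rename, upRen_comp]

theorem upSub_comp_upRen (r : Var → Var) (σ : Var → Tm) :
    upSub σ ∘ upRen r = upSub (σ ∘ r) := by
  funext x; cases x <;> rfl

theorem Tm.inst_rename (t : Tm) (r : Var → Var) (σ : Var → Tm) :
    (t.rename r).inst σ = t.inst (σ ∘ r) := by
  induction t generalizing r σ <;> simp_all [Tm.rename, Tm.inst, upSub_comp_upRen]

theorem rename_upSub (σ : Var → Tm) (r : Var → Var) :
    (fun x => (upSub σ x).rename (upRen r)) = upSub (fun x => (σ x).rename r) := by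
  funext x
  cases x with
  | zero => rfl
  | succ x => simp only [upSub, Tm.rename_rename]; rfl

theorem Tm.rename_inst (t : Tm) (σ : Var → Tm) (r : Var → Var) :
    (t.inst σ).rename r = t.inst (fun x => (σ x).rename r) := by
  induction t generalizing σ r <;> simp_all [Tm.rename, Tm.inst, rename_upSub]

theorem inst_upSub (σ τ : Var → Tm) :
    (fun x => (upSub σ x).inst (upSub τ)) = upSub (fun x => (σ x).inst τ) := by
  funext x
  cases x with
  | zero => rfl
  | succ x => simp only [upSub, Tm.inst_rename, Tm.rename_inst]; rfl

theorem Tm.inst_inst (t : Tm) (σ τ : Var → Tm) :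
    (t.inst σ).inst τ = t.inst (fun x => (σ x).inst τ) := by
  induction t generalizing σ τ <;> simp_all [Tm.inst, inst_upSub]

theorem Tm.inst_congr {t : Tm} {σ τ : Var → Tm} (h : ∀ x ∈ t.fv, σ x = τ x) :
    t.inst σ = t.inst τ := by
  induction t generalizing σ τ with
  | var x => exact h x rfl
  | lam t ih =>
    simp only [Tm.inst]
    refine congrArg _ (ih fun x hx => ?_)
    cases x with
    | zero => rfl
    | succ x => simp only [upSub, h x hx]
  | app t s iht ihs =>
    simp only [Tm.inst]
    rw [iht fun x hx => h x (Or.inl hx), ihs fun x hx => h x (Or.inr hx)]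
  | callcc => rfl
  | abort k t ih => simp only [Tm.inst]; rw [ih h]

theorem upSub_var : upSub Tm.var = Tm.var := by
  funext x; cases x <;> rfl

theorem Tm.inst_var (t : Tm) : t.inst Tm.var = t := by
  induction t <;> simp_all [Tm.inst, upSub_var]

theorem Tm.subst_of_notMem {t : Tm} {x : Var} (h : x ∉ t.fv) (v : Tm) : t.subst x v = t := by
  conv_rhs => rw [← t.inst_var]
  refine Tm.inst_congr fun y hy => if_neg ?_
  rintro rfl
  exact h hy

@[simp] theorem Tm.subst_var_self (x : Var) (v : Tm) : (Tm.var x).subst x v = v := by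
  simp [Tm.subst, Tm.inst]

theorem Tm.subst_var_of_ne {x y : Var} (h : y ≠ x) (v : Tm) :
    (Tm.var y).subst x v = .var y := by
  simp [Tm.subst, Tm.inst, h]

theorem Tm.subst_app (t s : Tm) (x : Var) (v : Tm) :
    (Tm.app t s).subst x v = .app (t.subst x v) (s.subst x v) := rfl

theorem Tm.IsVal.inst {v : Tm} (hv : v.IsVal) {σ : Var → Tm} (hσ : ∀ x, (σ x).IsVal) :
    (v.inst σ).IsVal := by
  cases v <;> simp_all [Tm.IsVal, Tm.inst]

theorem isVal_single {v : Tm} (hv : v.IsVal) (x y : Var) :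
    (if y = x then v else Tm.var y).IsVal := by
  split
  · exact hv
  · trivial

theorem Tm.IsVal.subst {v w : Tm} (hv : v.IsVal) (hw : w.IsVal) (x : Var) :
    (v.subst x w).IsVal :=
  hv.inst (isVal_single hw x)

theorem isVal_upSub {σ : Var → Tm} (hσ : ∀ x, (σ x).IsVal) (x : Var) : (upSub σ x).IsVal := by
  cases x with
  | zero => trivial
  | succ x => exact (hσ x).rename _

theorem Tm.IsVal.substc {v : Tm} (hv : v.IsVal) (c : CVar) (F : PCtx) : (v.substc c F).IsVal := by
  cases v <;> simp_all [Tm.IsVal, Tm.substc]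

/-- Substitution of values in an evaluation context. The side condition keeps the functions
on the left of a hole values. -/
def ECtx.inst (σ : Var → Tm) (hσ : ∀ x, (σ x).IsVal) : ECtx → ECtx
  | .hole => .hole
  | .appL E t => .appL (E.inst σ hσ) (t.inst σ)
  | .appR v hv E => .appR (v.inst σ) (hv.inst hσ) (E.inst σ hσ)

/-- Context substitution in an evaluation context. -/
def ECtx.substc (c : CVar) (F : PCtx) : ECtx → ECtx
  | .hole => .hole
  | .appL E t => .appL (E.substc c F) (t.substc c F)
  | .appR v hv E => .appR (v.substc c F) (hv.substc c F) (E.substc c F)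

/-- Composition: `E'` is put into the hole of `E`. -/
def ECtx.comp : ECtx → ECtx → ECtx
  | .hole, E' => E'
  | .appL E t, E' => .appL (E.comp E') t
  | .appR v hv E, E' => .appR v hv (E.comp E')

/-- Substitution of values in a program context. -/
def PCtx.inst (σ : Var → Tm) (hσ : ∀ x, (σ x).IsVal) (F : PCtx) : PCtx :=
  ⟨F.head, F.ectx.inst σ hσ⟩

/-- `G[v/x]` for a value `v`. -/
def PCtx.subst (G : PCtx) (x : Var) (v : Tm) (hv : v.IsVal) : PCtx :=
  G.inst _ (isVal_single hv x)

/-- `G[F/c]`: if `G` starts with `c`, the outcome is `F` with the rest of `G` in its hole. -/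
def PCtx.substc (G : PCtx) (c : CVar) (F : PCtx) : PCtx :=
  if G.head = some c then ⟨F.head, F.ectx.comp (G.ectx.substc c F)⟩
  else ⟨G.head, G.ectx.substc c F⟩

theorem ECtx.plug_comp (E E' : ECtx) (t : Tm) : (E.comp E').plug t = E.plug (E'.plug t) := by
  induction E <;> simp_all [ECtx.comp, ECtx.plug]

theorem ECtx.plug_rename (E : ECtx) (t : Tm) (r : Var → Var) :
    (E.plug t).rename r = (E.rename r).plug (t.rename r) := by
  induction E <;> simp_all [ECtx.rename, ECtx.plug, Tm.rename]

theorem ECtx.plug_inst (E : ECtx) (t : Tm) (σ : Var → Tm) (hσ : ∀ x, (σ x).IsVal) :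
    (E.plug t).inst σ = (E.inst σ hσ).plug (t.inst σ) := by
  induction E <;> simp_all [ECtx.inst, ECtx.plug, Tm.inst]

theorem ECtx.plug_substc (E : ECtx) (t : Tm) (c : CVar) (F : PCtx) :
    (E.plug t).substc c F = (E.substc c F).plug (t.substc c F) := by
  induction E <;> simp_all [ECtx.substc, ECtx.plug, Tm.substc]

theorem PCtx.plug_subst (G : PCtx) (t : Tm) (x : Var) {v : Tm} (hv : v.IsVal) :
    (G.plug t).subst x v = (G.subst x v hv).plug (t.subst x v) := by
  simp only [PCtx.plug, Prog.subst, PCtx.subst, PCtx.inst, Tm.subst, ← ECtx.plug_inst]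

theorem PCtx.plug_substc (G : PCtx) (t : Tm) (c : CVar) (F : PCtx) :
    (G.plug t).substc c F = (G.substc c F).plug (t.substc c F) := by
  by_cases h : G.head = some c <;>
    simp [PCtx.plug, Prog.substc, PCtx.substc, h, ECtx.plug_substc, ECtx.plug_comp]

theorem ECtx.rename_rename (E : ECtx) (r r' : Var → Var) :
    (E.rename r).rename r' = E.rename (r' ∘ r) := by
  induction E <;> simp_all [ECtx.rename, Tm.rename_rename]

theorem PCtx.rename_succ_rename (F : PCtx) (r : Var → Var) :
    (F.rename Nat.succ).rename (upRen r) = (F.rename r).rename Nat.succ := by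
  simp only [PCtx.rename, ECtx.rename_rename]; rfl

theorem ECtx.rename_comp (E E' : ECtx) (r : Var → Var) :
    (E.comp E').rename r = (E.rename r).comp (E'.rename r) := by
  induction E <;> simp_all [ECtx.rename, ECtx.comp]

theorem ECtx.inst_rename_succ (E : ECtx) (σ : Var → Tm) (hσ : ∀ x, (σ x).IsVal) :
    (E.rename Nat.succ).inst (upSub σ) (isVal_upSub hσ) = (E.inst σ hσ).rename Nat.succ := by
  induction E <;>
    simp_all [ECtx.rename, ECtx.inst, Tm.inst_rename, Tm.rename_inst, Function.comp_def, upSub]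

theorem ECtx.inst_eq_self {E : ECtx} {σ : Var → Tm} (hσ : ∀ x, (σ x).IsVal)
    (h : ∀ x ∈ E.fv, σ x = .var x) : E.inst σ hσ = E := by
  have key : ∀ t : Tm, (∀ x ∈ t.fv, σ x = .var x) → t.inst σ = t := fun t ht =>
    (Tm.inst_congr ht).trans t.inst_var
  induction E with
  | hole => rfl
  | appL E t ih =>
    simp only [ECtx.inst]
    rw [ih fun x hx => h x (Or.inl hx), key t fun x hx => h x (Or.inr hx)]
  | appR v hv E ih =>
    simp only [ECtx.inst]
    congr 1
    · exact key v fun x hx => h x (Or.inl hx)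
    · exact ih fun x hx => h x (Or.inr hx)

theorem PCtx.subst_of_notMem {F : PCtx} {x : Var} (h : x ∉ F.fv) {v : Tm} (hv : v.IsVal) :
    F.subst x v hv = F := by
  have : F.ectx.inst _ (isVal_single hv x) = F.ectx :=
    ECtx.inst_eq_self _ fun y hy => if_neg (by rintro rfl; exact h hy)
  simp only [PCtx.subst, PCtx.inst, this]

theorem PCtx.plug_var_subst {F : PCtx} {x : Var} (h : x ∉ F.fv) {v : Tm} (hv : v.IsVal) :
    (F.plug (.var x)).subst x v = F.plug v := by
  rw [PCtx.plug_subst _ _ _ hv, PCtx.subst_of_notMem h, Tm.subst_var_self]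

theorem Tm.substc_rename (t : Tm) (r : Var → Var) (c : CVar) (F : PCtx) :
    (t.rename r).substc c (F.rename r) = (t.substc c F).rename r := by
  induction t generalizing r F with
  | var x => rfl
  | lam t ih => simp only [Tm.rename, Tm.substc, ← PCtx.rename_succ_rename, ih]
  | app t s iht ihs => simp only [Tm.rename, Tm.substc, iht, ihs]
  | callcc => rfl
  | abort h t ih =>
    simp only [Tm.rename, Tm.substc, ih]
    split
    · simp only [PCtx.plug, PCtx.rename, Prog.abort, Tm.rename, ECtx.plug_rename]
    · rfl

theorem ECtx.substc_rename (E : ECtx) (r : Var → Var) (c : CVar) (F : PCtx) :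
    (E.rename r).substc c (F.rename r) = (E.substc c F).rename r := by
  induction E <;> simp_all [ECtx.rename, ECtx.substc, Tm.substc_rename]

theorem PCtx.substc_rename (G : PCtx) (r : Var → Var) (c : CVar) (F : PCtx) :
    (G.rename r).substc c (F.rename r) = (G.substc c F).rename r := by
  by_cases h : G.head = some c <;>
    simp only [PCtx.substc, PCtx.rename, h, if_true, if_false, ECtx.rename_comp,
      ← ECtx.substc_rename]

/-- Context substitution commutes with the substitution of values. For a β-reduction, `F'` is
`F` shifted below the abstraction, and instantiating the bound variable gives back `F`. -/
theorem Tm.substc_inst (c : CVar) (t : Tm) {σ τ : Var → Tm} (hτ : ∀ x, (τ x).IsVal)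
    {F F' : PCtx} (h : ∀ x, (σ x).substc c F = τ x) (hF : F'.inst τ hτ = F) :
    (t.inst σ).substc c F = (t.substc c F').inst τ := by
  induction t generalizing σ τ F F' with
  | var x => exact h x
  | lam t ih =>
    simp only [Tm.inst, Tm.substc]
    refine congrArg _ (ih (isVal_upSub hτ) (fun x => ?_) ?_)
    · cases x with
      | zero => rfl
      | succ x => simp only [upSub, Tm.substc_rename, h]
    · subst hF
      exact congrArg (PCtx.mk _) (ECtx.inst_rename_succ _ _ hτ)
  | app t s iht ihs => simp only [Tm.inst, Tm.substc, iht hτ h hF, ihs hτ h hF]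
  | callcc => rfl
  | abort k t ih =>
    simp only [Tm.inst, Tm.substc, ih hτ h hF]
    split
    · subst hF
      simp only [PCtx.plug, Prog.abort, Tm.inst, PCtx.inst, ECtx.plug_inst _ _ _ hτ]
    · rfl

/-- The substitution performed by a β-reduction with argument `v`. -/
def betaSub (v : Tm) : Var → Tm
  | 0 => v
  | x + 1 => .var x

theorem Tm.beta_eq (t v : Tm) : t.beta v = t.inst (betaSub v) := by
  refine Tm.inst_congr fun x _ => ?_
  cases x <;> rfl

theorem isVal_betaSub {v : Tm} (hv : v.IsVal) (x : Var) : (betaSub v x).IsVal := by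
  cases x with
  | zero => exact hv
  | succ x => trivial

theorem Tm.beta_inst (t v : Tm) (σ : Var → Tm) :
    (t.beta v).inst σ = (t.inst (upSub σ)).beta (v.inst σ) := by
  simp only [Tm.beta_eq, Tm.inst_inst]
  refine Tm.inst_congr fun x _ => ?_
  cases x with
  | zero => rfl
  | succ x =>
    simp only [betaSub, upSub, Tm.inst_rename]
    exact (σ x).inst_var.symm

theorem ECtx.rename_succ_inst_betaSub (E : ECtx) {v : Tm} (hv : v.IsVal) :
    (E.rename Nat.succ).inst (betaSub v) (isVal_betaSub hv) = E := by
  have key : ∀ t : Tm, (t.rename Nat.succ).inst (betaSub v) = t := fun t => by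
    rw [Tm.inst_rename]; exact t.inst_var
  induction E <;> simp_all [ECtx.rename, ECtx.inst]

theorem Tm.beta_substc (t : Tm) {v : Tm} (hv : v.IsVal) (c : CVar) (F : PCtx) :
    (t.beta v).substc c F = (t.substc c (F.rename Nat.succ)).beta (v.substc c F) := by
  simp only [Tm.beta_eq]
  refine Tm.substc_inst c t (isVal_betaSub (hv.substc c F)) (fun x => ?_) ?_
  · cases x <;> rfl
  · exact congrArg (PCtx.mk _) (ECtx.rename_succ_inst_betaSub _ (hv.substc c F))

theorem PCtx.reify_inst (F : PCtx) (σ : Var → Tm) (hσ : ∀ x, (σ x).IsVal) :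
    F.reify.inst σ = (F.inst σ hσ).reify := by
  simp only [PCtx.reify, PCtx.inst, PCtx.rename, PCtx.plug, Prog.abort, Tm.inst,
    ECtx.plug_inst _ _ _ (isVal_upSub hσ), upSub]
  rw [ECtx.inst_rename_succ]

theorem Prog.abort_substc (p : Prog) (c : CVar) (F : PCtx) :
    p.abort.substc c F = (p.substc c F).abort := by
  by_cases h : p.head = some c <;> simp [Prog.abort, Prog.substc, Tm.substc, h]

theorem PCtx.reify_substc (G : PCtx) (c : CVar) (F : PCtx) :
    G.reify.substc c F = (G.substc c F).reify := by
  simp only [PCtx.reify, Tm.substc]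
  rw [Prog.abort_substc, PCtx.plug_substc, PCtx.substc_rename]
  rfl

/-! ### Free variables -/

theorem Tm.finite_fv (t : Tm) : t.fv.Finite := by
  induction t with
  | var x => exact Set.finite_singleton x
  | lam t ih => exact ih.preimage (Nat.succ_injective.injOn)
  | app t s iht ihs => exact iht.union ihs
  | callcc => exact Set.finite_empty
  | abort h t ih => exact ih

theorem Tm.finite_fk (t : Tm) : t.fk.Finite := by
  induction t with
  | var x => exact Set.finite_empty
  | lam t ih => exact ih
  | app t s iht ihs => exact iht.union ihs
  | callcc => exact Set.finite_empty
  | abort h t ih =>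
    refine Set.Finite.union ?_ ih
    cases h with
    | none => simp
    | some c => simp

theorem PCtx.finite_fv (F : PCtx) : F.fv.Finite := by
  obtain ⟨h, E⟩ := F
  change E.fv.Finite
  induction E with
  | hole => exact Set.finite_empty
  | appL E t ih => exact ih.union t.finite_fv
  | appR v hv E ih => exact v.finite_fv.union ih

theorem Tm.substc_of_notMem {t : Tm} {c : CVar} (h : c ∉ t.fk) (F : PCtx) :
    t.substc c F = t := by
  induction t generalizing F with
  | var x => rfl
  | lam t ih => simp only [Tm.substc, ih h]
  | app t s iht ihs =>
    simp only [Tm.substc, iht fun h' => h (Or.inl h'), ihs fun h' => h (Or.inr h')]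
  | callcc => rfl
  | abort k t ih =>
    have hk : k ≠ some c := fun h' => h (Or.inl h')
    simp only [Tm.substc, ih fun h' => h (Or.inr h'), if_neg hk]

theorem Tm.fk_rename (t : Tm) (r : Var → Var) : (t.rename r).fk = t.fk := by
  induction t generalizing r <;> simp_all [Tm.rename, Tm.fk]

theorem Tm.exists_of_mem_fv_rename {t : Tm} {r : Var → Var} {y : Var}
    (h : y ∈ (t.rename r).fv) : ∃ x ∈ t.fv, r x = y := by
  induction t generalizing r y with
  | var x => exact ⟨x, rfl, h.symm⟩
  | lam t ih =>
    obtain ⟨x, hx, hxy⟩ := ih (y := y + 1) h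
    cases x with
    | zero => cases hxy
    | succ x => exact ⟨x, hx, Nat.succ_injective hxy⟩
  | app t s iht ihs =>
    rcases h with h | h
    · obtain ⟨x, hx, hxy⟩ := iht h
      exact ⟨x, Or.inl hx, hxy⟩
    · obtain ⟨x, hx, hxy⟩ := ihs h
      exact ⟨x, Or.inr hx, hxy⟩
  | callcc => cases h
  | abort k t ih => exact ih h

theorem Tm.notMem_fv_abs (x : Var) (t : Tm) : x ∉ (Tm.abs x t).fv := by
  intro h
  obtain ⟨y, -, hy⟩ := Tm.exists_of_mem_fv_rename (y := x + 1) h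
  split at hy
  · cases hy
  · exact absurd (Nat.succ_injective hy) ‹_›

theorem Tm.beta_abs (x : Var) (t : Tm) :
    (t.rename (fun y => if y = x then 0 else y + 1)).beta (.var x) = t := by
  rw [Tm.beta_eq, Tm.inst_rename]
  conv_rhs => rw [← t.inst_var]
  refine Tm.inst_congr fun y _ => ?_
  by_cases h : y = x <;> simp [h, betaSub]

/-! ### Decomposition and determinism -/

/-- The terms that occupy the hole of an evaluation context when a program is not a value:
applications of values, including the stuck ones `x v`, and aborts. -/
def Tm.IsFocus : Tm → Prop
  | .app v w => v.IsVal ∧ w.IsVal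
  | .abort _ _ => True
  | _ => False

theorem ECtx.not_isVal_plug (E : ECtx) {r : Tm} (hr : r.IsFocus) : ¬ (E.plug r).IsVal := by
  cases E with
  | hole => cases r <;> simp_all [ECtx.plug, Tm.IsFocus, Tm.IsVal]
  | appL E t => exact id
  | appR v hv E => exact id

theorem ECtx.plug_inj {E E' : ECtx} {r r' : Tm} (hr : r.IsFocus) (hr' : r'.IsFocus)
    (h : E.plug r = E'.plug r') : E = E' ∧ r = r' := by
  induction E generalizing E' with
  | hole =>
    cases E' with
    | hole => exact ⟨rfl, h⟩
    | appL E' t =>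
      simp only [ECtx.plug] at h
      subst h
      exact (E'.not_isVal_plug hr' hr.1).elim
    | appR v hv E' =>
      simp only [ECtx.plug] at h
      subst h
      exact (E'.not_isVal_plug hr' hr.2).elim
  | appL E t ih =>
    cases E' with
    | hole =>
      simp only [ECtx.plug] at h
      subst h
      exact (E.not_isVal_plug hr hr'.1).elim
    | appL E' t' =>
      simp only [ECtx.plug, Tm.app.injEq] at h
      obtain ⟨rfl, rfl⟩ := ih h.1
      exact ⟨by rw [h.2], rfl⟩
    | appR v hv E' =>
      simp only [ECtx.plug, Tm.app.injEq] at h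
      exact (E.not_isVal_plug hr (h.1 ▸ hv)).elim
  | appR v hv E ih =>
    cases E' with
    | hole =>
      simp only [ECtx.plug] at h
      subst h
      exact (E.not_isVal_plug hr hr'.2).elim
    | appL E' t' =>
      simp only [ECtx.plug, Tm.app.injEq] at h
      exact (E'.not_isVal_plug hr' (h.1 ▸ hv)).elim
    | appR v' hv' E' =>
      simp only [ECtx.plug, Tm.app.injEq] at h
      obtain ⟨rfl, rfl⟩ := ih h.2
      obtain ⟨rfl, -⟩ := h
      exact ⟨rfl, rfl⟩

theorem PCtx.plug_inj {F F' : PCtx} {r r' : Tm} (hr : r.IsFocus) (hr' : r'.IsFocus)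
    (h : F.plug r = F'.plug r') : F = F' ∧ r = r' := by
  obtain ⟨k, E⟩ := F
  obtain ⟨k', E'⟩ := F'
  simp only [PCtx.plug, Prog.mk.injEq] at h
  obtain ⟨rfl, rfl⟩ := ECtx.plug_inj hr hr' h.2
  exact ⟨by rw [h.1], rfl⟩

theorem Tm.isVal_or_exists_plug (t : Tm) :
    t.IsVal ∨ ∃ (E : ECtx) (r : Tm), r.IsFocus ∧ t = E.plug r := by
  induction t with
  | var x => exact Or.inl trivial
  | lam t => exact Or.inl trivial
  | app t s iht ihs =>
    right
    rcases iht with ht | ⟨E, r, hr, rfl⟩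
    · rcases ihs with hs | ⟨E, r, hr, rfl⟩
      · exact ⟨.hole, .app t s, ⟨ht, hs⟩, rfl⟩
      · exact ⟨.appR t ht E, r, hr, rfl⟩
    · exact ⟨.appL E s, r, hr, rfl⟩
  | callcc => exact Or.inl trivial
  | abort h t => exact Or.inr ⟨.hole, .abort h t, trivial, rfl⟩

/-- The reduct of `F[r]` for a term `r` in focus, if there is one. -/
def contract (F : PCtx) : Tm → Option Prog
  | .app (.lam t) v => some (F.plug (t.beta v))
  | .app .callcc v => some (F.plug (.app v F.reify))
  | .abort h t => some ⟨h, t⟩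
  | _ => none

theorem red_plug_iff {F : PCtx} {r : Tm} (hr : r.IsFocus) {p : Prog} :
    Red (F.plug r) p ↔ contract F r = some p := by
  constructor
  · intro h
    generalize hq : F.plug r = q at h
    cases h with
    | beta F' t v hv =>
      obtain ⟨rfl, rfl⟩ := PCtx.plug_inj (r' := .app (.lam t) v) hr ⟨trivial, hv⟩ hq
      rfl
    | callcc F' v hv =>
      obtain ⟨rfl, rfl⟩ := PCtx.plug_inj (r' := .app .callcc v) hr ⟨trivial, hv⟩ hq
      rfl
    | abort F' p =>
      obtain ⟨rfl, rfl⟩ := PCtx.plug_inj (r' := p.abort) hr trivial hq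
      rfl
  · intro h
    unfold contract at h
    split at h <;> cases h
    · exact .beta F _ _ hr.2
    · exact .callcc F _ hr.2
    · exact .abort F ⟨_, _⟩

theorem Red.exists_focus {p p' : Prog} (h : Red p p') :
    ∃ (F : PCtx) (r : Tm), r.IsFocus ∧ p = F.plug r := by
  cases h with
  | beta F t v hv => exact ⟨F, .app (.lam t) v, ⟨trivial, hv⟩, rfl⟩
  | callcc F v hv => exact ⟨F, .app .callcc v, ⟨trivial, hv⟩, rfl⟩
  | abort F p => exact ⟨F, p'.abort, trivial, rfl⟩

theorem Red.deterministic {p p' p'' : Prog} (h : Red p p') (h' : Red p p'') : p' = p'' := by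
  obtain ⟨F, r, hr, rfl⟩ := h.exists_focus
  rw [red_plug_iff hr] at h h'
  exact Option.some_injective _ (h.symm.trans h')

theorem not_red_of_isVal {p p' : Prog} (h : p.body.IsVal) : ¬ Red p p' := by
  intro h'
  obtain ⟨F, r, hr, rfl⟩ := h'.exists_focus
  exact F.ectx.not_isVal_plug hr h

theorem isFocus_stuck {x : Var} {v : Tm} (hv : v.IsVal) : (Tm.app (.var x) v).IsFocus :=
  ⟨trivial, hv⟩

theorem not_red_stuck {F : PCtx} {x : Var} {v : Tm} (hv : v.IsVal) {p : Prog} :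
    ¬ Red (F.plug (.app (.var x) v)) p := by
  rw [red_plug_iff (isFocus_stuck hv)]
  simp [contract]

theorem stuck_inj {F F' : PCtx} {x x' : Var} {v v' : Tm} (hv : v.IsVal) (hv' : v'.IsVal)
    (h : F.plug (.app (.var x) v) = F'.plug (.app (.var x') v')) :
    F = F' ∧ x = x' ∧ v = v' := by
  obtain ⟨rfl, h'⟩ := PCtx.plug_inj (isFocus_stuck hv) (isFocus_stuck hv') h
  simp only [Tm.app.injEq, Tm.var.injEq] at h'
  exact ⟨rfl, h'⟩

theorem not_isVal_stuck (F : PCtx) {x : Var} {v : Tm} (hv : v.IsVal) :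
    ¬ (F.plug (.app (.var x) v)).body.IsVal :=
  F.ectx.not_isVal_plug (isFocus_stuck hv)

/-- Every program is a value, or a value in a context variable, or open stuck, or reduces. -/
theorem Prog.classify (p : Prog) :
    (∃ v, v.IsVal ∧ p = .ofTm v) ∨ (∃ c v, v.IsVal ∧ p = .inCtx c v) ∨
      (∃ (F : PCtx) (x : Var) (v : Tm), v.IsVal ∧ p = F.plug (.app (.var x) v)) ∨
        ∃ p', Red p p' := by
  obtain ⟨k, t⟩ := p
  rcases t.isVal_or_exists_plug with ht | ⟨E, r, hr, rfl⟩
  · cases k with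
    | none => exact Or.inl ⟨t, ht, rfl⟩
    | some c => exact Or.inr (Or.inl ⟨c, t, ht, rfl⟩)
  · right; right
    have key := @red_plug_iff ⟨k, E⟩ r hr
    match r, hr with
    | .app (.var x) v, hr => exact Or.inl ⟨⟨k, E⟩, x, v, hr.2, rfl⟩
    | .app (.lam t) v, _ => exact Or.inr ⟨_, key.2 rfl⟩
    | .app .callcc v, _ => exact Or.inr ⟨_, key.2 rfl⟩
    | .abort h t, _ => exact Or.inr ⟨_, key.2 rfl⟩

theorem Red.subst {p p' : Prog} (h : Red p p') (x : Var) {v : Tm} (hv : v.IsVal) :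
    Red (p.subst x v) (p'.subst x v) := by
  cases h with
  | beta F t u hu =>
    rw [PCtx.plug_subst _ _ _ hv, PCtx.plug_subst _ _ _ hv]
    rw [Tm.subst, Tm.subst, Tm.beta_inst]
    exact .beta _ _ _ (hu.subst hv x)
  | callcc F u hu =>
    rw [PCtx.plug_subst _ _ _ hv, PCtx.plug_subst _ _ _ hv, Tm.subst_app u,
      show F.reify.subst x v = (F.subst x v hv).reify from PCtx.reify_inst _ _ _]
    exact .callcc _ _ (hu.subst hv x)
  | abort F p =>
    rw [PCtx.plug_subst _ _ _ hv]
    exact .abort _ (p'.subst x v)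

theorem Red.substc {p p' : Prog} (h : Red p p') (c : CVar) (F : PCtx) :
    Red (p.substc c F) (p'.substc c F) := by
  cases h with
  | beta G t u hu =>
    rw [PCtx.plug_substc, PCtx.plug_substc, Tm.beta_substc _ hu]
    exact .beta _ _ _ (hu.substc c F)
  | callcc G u hu =>
    rw [PCtx.plug_substc, PCtx.plug_substc, Tm.substc, Tm.substc, Tm.substc, PCtx.reify_substc]
    exact .callcc _ _ (hu.substc c F)
  | abort G p =>
    rw [PCtx.plug_substc, Prog.abort_substc]
    exact .abort _ _

theorem Reds.subst {p p' : Prog} (h : Reds p p') (x : Var) {v : Tm} (hv : v.IsVal) :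
    Reds (p.subst x v) (p'.subst x v) :=
  Relation.ReflTransGen.lift (fun p : Prog => p.subst x v) (fun _ _ h => h.subst x hv) _ _ h

theorem Reds.substc {p p' : Prog} (h : Reds p p') (c : CVar) (F : PCtx) :
    Reds (p.substc c F) (p'.substc c F) :=
  Relation.ReflTransGen.lift (fun p : Prog => p.substc c F) (fun _ _ h => h.substc c F) _ _ h

theorem Reds.eq_of_normal {p q : Prog} (h : Reds p q) (hp : ∀ r, ¬ Red p r) : p = q := by
  cases Relation.ReflTransGen.cases_head h with
  | inl h => exact h
  | inr h => exact (hp _ h.choose_spec.1).elim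

/-! ### Progress through an inductive matching predicate -/

/-- The conditions that diacritical progress puts on the left program of a pair, by the shape
of that program: it reduces, or is a value, or is open stuck, or is a value in a context
variable. As exactly one of the cases applies to each program, this existential reading agrees
with the implications of `Progress`. -/
inductive Matches (S T : PRel) : Prog → Prog → Prop
  | red {p p' q q' : Prog} (h : Red p p') (hq : Reds q q') (ht : (p', q') ∈ T) : Matches S T p q
  | val {v w : Tm} {q : Prog} (hv : v.IsVal) (hw : w.IsVal) (hq : Reds q (.ofTm w)) :
      Matches S T (.ofTm v) q
  | stuck {F F' : PCtx} {x : Var} {v w : Tm} {q : Prog} (hv : v.IsVal) (hw : w.IsVal)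
      (hq : Reds q (F'.plug (.app (.var x) w))) (hF : TestCtx T F F') (hvw : TestVal T v w) :
      Matches S T (F.plug (.app (.var x) v)) q
  | ctxVal {c : CVar} {v w : Tm} {q : Prog} (hv : v.IsVal) (hw : w.IsVal)
      (hq : Reds q (.inCtx c w)) (hvw : TestVal S v w) : Matches S T (.inCtx c v) q

/-- The converse relation. -/
def swapRel (R : PRel) : PRel := {pq | (pq.2, pq.1) ∈ R}

theorem swapRel_mono {R S : PRel} (h : R ⊆ S) : swapRel R ⊆ swapRel S := fun _ hx => h hx

theorem TestTm.mono {R S : PRel} (h : R ⊆ S) {t s : Tm} : TestTm R t s → TestTm S t s :=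
  fun ⟨c, h1, h2, h3⟩ => ⟨c, h1, h2, h h3⟩

theorem TestVal.mono {R S : PRel} (h : R ⊆ S) {v w : Tm} : TestVal R v w → TestVal S v w :=
  fun ⟨x, h1, h2, h3⟩ => ⟨x, h1, h2, h3.mono h⟩

theorem TestCtx.mono {R S : PRel} (h : R ⊆ S) {F F' : PCtx} : TestCtx R F F' → TestCtx S F F' :=
  fun ⟨x, h1, h2, h3⟩ => ⟨x, h1, h2, h h3⟩

theorem TestTm.swap {R : PRel} {t s : Tm} : TestTm R t s → TestTm (swapRel R) s t :=
  fun ⟨c, h1, h2, h3⟩ => ⟨c, h2, h1, h3⟩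

theorem TestVal.swap {R : PRel} {v w : Tm} : TestVal R v w → TestVal (swapRel R) w v :=
  fun ⟨x, h1, h2, h3⟩ => ⟨x, h2, h1, h3.swap⟩

theorem TestCtx.swap {R : PRel} {F F' : PCtx} : TestCtx R F F' → TestCtx (swapRel R) F' F :=
  fun ⟨x, h1, h2, h3⟩ => ⟨x, h2, h1, h3⟩

theorem TestOpen.swap {R : PRel} {p q : Prog} : TestOpen R p q → TestOpen (swapRel R) q p :=
  fun ⟨F, F', x, v, w, hv, hw, hp, hq, hF, hvw⟩ =>
    ⟨F', F, x, w, v, hw, hv, hq, hp, hF.swap, hvw.swap⟩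

theorem Progress.swap {R S T : PRel} (h : Progress R S T) :
    Progress (swapRel R) (swapRel S) (swapRel T) where
  sub_passive _ hpq := h.sub_passive hpq
  passive_sub _ hpq := h.passive_sub hpq
  red p q hpq := h.red_conv q p hpq
  val p q hpq := h.val_conv q p hpq
  stuck p q hpq F x v hv hp :=
    let ⟨F', w, hw, he, ho⟩ := h.stuck_conv q p hpq F x v hv hp
    ⟨F', w, hw, he, ho.swap⟩
  ctxVal p q hpq c v hv hp :=
    let ⟨w, hw, he, ht⟩ := h.ctxVal_conv q p hpq c v hv hp
    ⟨w, hw, he, ht.swap⟩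
  red_conv p q hpq := h.red q p hpq
  val_conv p q hpq := h.val q p hpq
  stuck_conv p q hpq F x v hv hp :=
    let ⟨F', w, hw, he, ho⟩ := h.stuck q p hpq F x v hv hp
    ⟨F', w, hw, he, ho.swap⟩
  ctxVal_conv p q hpq c v hv hp :=
    let ⟨w, hw, he, ht⟩ := h.ctxVal q p hpq c v hv hp
    ⟨w, hw, he, ht.swap⟩

theorem Matches.mono {S S' T T' : PRel} (hS : S ⊆ S') (hT : T ⊆ T') {p q : Prog}
    (h : Matches S T p q) : Matches S' T' p q := by
  cases h with
  | red h hq ht => exact .red h hq (hT ht)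
  | val hv hw hq => exact .val hv hw hq
  | stuck hv hw hq hF hvw => exact .stuck hv hw hq (hF.mono hT) (hvw.mono hT)
  | ctxVal hv hw hq hvw => exact .ctxVal hv hw hq (hvw.mono hS)

theorem Matches.of_reds {S T : PRel} {p q q' : Prog} (hq' : Reds q q')
    (h : Matches S T p q') : Matches S T p q := by
  cases h with
  | red h hq ht => exact .red h (hq'.trans hq) ht
  | val hv hw hq => exact .val hv hw (hq'.trans hq)
  | stuck hv hw hq hF hvw => exact .stuck hv hw (hq'.trans hq) hF hvw
  | ctxVal hv hw hq hvw => exact .ctxVal hv hw (hq'.trans hq) hvw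

theorem Progress.matches {R S T : PRel} (h : Progress R S T) {p q : Prog} (hpq : (p, q) ∈ R) :
    Matches S T p q := by
  rcases p.classify with ⟨v, hv, rfl⟩ | ⟨c, v, hv, rfl⟩ | ⟨F, x, v, hv, rfl⟩ | ⟨p', hp⟩
  · obtain ⟨w, hw, he⟩ := h.val _ _ hpq v hv rfl
    exact .val hv hw he.1
  · obtain ⟨w, hw, he, ht⟩ := h.ctxVal _ _ hpq c v hv rfl
    exact .ctxVal hv hw he.1 ht
  · obtain ⟨F', w, hw, he, G, G', y, a, b, ha, hb, hp, hq, hG, hab⟩ :=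
      h.stuck _ _ hpq F x v hv rfl
    obtain ⟨rfl, rfl, rfl⟩ := stuck_inj hv ha hp
    obtain ⟨rfl, -, rfl⟩ := stuck_inj hw hb hq
    exact .stuck hv hw he.1 hG hab
  · obtain ⟨q', hq, ht⟩ := h.red _ _ hpq p' hp
    exact .red hp hq ht

theorem Matches.red_left {S T : PRel} {p q p' : Prog} (h : Matches S T p q) (hp : Red p p') :
    ∃ q', Reds q q' ∧ (p', q') ∈ T := by
  cases h with
  | red h hq ht =>
    obtain rfl := h.deterministic hp
    exact ⟨_, hq, ht⟩
  | val hv _ _ => exact (not_red_of_isVal hv hp).elim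
  | stuck hv _ _ _ _ => exact (not_red_stuck hv hp).elim
  | ctxVal hv _ _ _ => exact (not_red_of_isVal hv hp).elim

theorem Matches.val_left {S T : PRel} {v : Tm} {q : Prog} (h : Matches S T (.ofTm v) q)
    (hv : v.IsVal) : ∃ w, w.IsVal ∧ Eval q (.ofTm w) := by
  generalize hp : Prog.ofTm v = p at h
  cases h with
  | red h _ _ => subst hp; exact (not_red_of_isVal hv h).elim
  | val _ hw hq => exact ⟨_, hw, hq, fun _ => not_red_of_isVal hw⟩
  | stuck ha _ _ _ _ => exact (not_isVal_stuck _ ha (by rw [← hp]; exact hv)).elim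
  | ctxVal _ _ _ _ => cases hp

theorem Matches.ctxVal_left {S T : PRel} {c : CVar} {v : Tm} {q : Prog}
    (h : Matches S T (.inCtx c v) q) (hv : v.IsVal) :
    ∃ w, w.IsVal ∧ Eval q (.inCtx c w) ∧ TestVal S v w := by
  generalize hp : Prog.inCtx c v = p at h
  cases h with
  | red h _ _ => subst hp; exact (not_red_of_isVal hv h).elim
  | val _ _ _ => cases hp
  | stuck ha _ _ _ _ => exact (not_isVal_stuck _ ha (by rw [← hp]; exact hv)).elim
  | ctxVal _ hw hq hvw =>
    cases hp
    exact ⟨_, hw, ⟨hq, fun _ => not_red_of_isVal hw⟩, hvw⟩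

theorem Matches.stuck_left {S T : PRel} {F : PCtx} {x : Var} {v : Tm} {q : Prog}
    (h : Matches S T (F.plug (.app (.var x) v)) q) (hv : v.IsVal) :
    ∃ F' w, w.IsVal ∧ Eval q (PCtx.plug F' (.app (.var x) w)) ∧ TestCtx T F F' ∧
      TestVal T v w := by
  generalize hp : F.plug (.app (.var x) v) = p at h
  cases h with
  | red h _ _ => subst hp; exact (not_red_stuck hv h).elim
  | val ha _ _ => exact (not_isVal_stuck F hv (by rw [hp]; exact ha)).elim
  | stuck ha hw hq hF hvw =>
    obtain ⟨rfl, rfl, rfl⟩ := stuck_inj hv ha hp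
    exact ⟨_, _, hw, ⟨hq, fun _ => not_red_stuck hw⟩, hF, hvw⟩
  | ctxVal ha _ _ _ => exact (not_isVal_stuck F hv (by rw [hp]; exact ha)).elim

theorem Progress.of_matches {R S T : PRel} (hRS : R ⊆ S) (hST : S ⊆ T)
    (h : ∀ p q, (p, q) ∈ R → Matches S T p q)
    (h' : ∀ p q, (p, q) ∈ R → Matches (swapRel S) (swapRel T) q p) : Progress R S T where
  sub_passive := hRS
  passive_sub := hST
  red p q hpq p' hp := (h p q hpq).red_left hp
  val p q hpq v hv hp := by subst hp; exact (h _ q hpq).val_left hv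
  stuck p q hpq F x v hv hp := by
    subst hp
    obtain ⟨F', w, hw, he, hF, hvw⟩ := (h _ q hpq).stuck_left hv
    exact ⟨F', w, hw, he, F, F', x, v, w, hv, hw, rfl, rfl, hF, hvw⟩
  ctxVal p q hpq c v hv hp := by subst hp; exact (h _ q hpq).ctxVal_left hv
  red_conv p q hpq q' hq := (h' p q hpq).red_left hq
  val_conv p q hpq v hv hq := by subst hq; exact (h' p _ hpq).val_left hv
  stuck_conv p q hpq F x v hv hq := by
    subst hq
    obtain ⟨F', w, hw, he, hF, hvw⟩ := (h' p _ hpq).stuck_left hv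
    exact ⟨F', w, hw, he, F', F, x, w, v, hw, hv, rfl, rfl, hF.swap, hvw.swap⟩
  ctxVal_conv p q hpq c v hv hq := by
    subst hq
    obtain ⟨w, hw, he, hvw⟩ := (h' p _ hpq).ctxVal_left hv
    exact ⟨w, hw, he, hvw.swap⟩

theorem Progress.mono {R S T S' T' : PRel} (h : Progress R S T) (hS : S ⊆ S') (hT : T ⊆ T')
    (hST : S' ⊆ T') : Progress R S' T' :=
  .of_matches (h.sub_passive.trans hS) hST
    (fun _ _ hpq => (h.matches hpq).mono hS hT)
    (fun p q hpq => (h.swap.matches (p := q) (q := p) hpq).mono (swapRel_mono hS)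
      (swapRel_mono hT))

theorem Progress.iUnion {ι : Type*} {R S : ι → PRel} {T : PRel}
    (h : ∀ i, Progress (R i) (S i) T) : Progress (⋃ i, R i) (⋃ i, S i) T := by
  have key := fun i => (h i).mono (Set.subset_iUnion S i) subset_rfl
    (Set.iUnion_subset fun i => (h i).passive_sub)
  refine .of_matches (Set.iUnion_mono fun i => (h i).sub_passive)
    (Set.iUnion_subset fun i => (h i).passive_sub) (fun p q hpq => ?_) (fun p q hpq => ?_) <;>
  obtain ⟨i, hi⟩ := Set.mem_iUnion.1 hpq
  · exact (key i).matches hi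
  · exact (key i).swap.matches hi

theorem Progress.union {R R' S T : PRel} (h : Progress R S T) (h' : Progress R' S T) :
    Progress (R ∪ R') S T := by
  refine .of_matches (Set.union_subset h.sub_passive h'.sub_passive) h.passive_sub
    (fun p q hpq => ?_) (fun p q hpq => ?_)
  · exact hpq.elim h.matches h'.matches
  · exact hpq.elim h.swap.matches h'.swap.matches

theorem isBisim_bisim : IsBisim bisim := by
  have key : ∀ R ∈ {R | IsBisim R}, Progress R bisim bisim := fun R hR =>
    Progress.mono hR (Set.subset_sUnion_of_mem hR) (Set.subset_sUnion_of_mem hR) subset_rfl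
  refine .of_matches subset_rfl subset_rfl (fun p q hpq => ?_) (fun p q hpq => ?_) <;>
  obtain ⟨R, hR, hRpq⟩ := hpq
  · exact (key R hR).matches hRpq
  · exact (key R hR).swap.matches hRpq

theorem subset_bisim {R : PRel} (h : IsBisim R) : R ⊆ bisim :=
  Set.subset_sUnion_of_mem h

/-! ### Closures and soundness of diacritically compatible families -/

/-- `X` is closed under every function of the family. -/
def ClosedUnder (𝓕 : Set RelFun) (X : PRel) : Prop := ∀ f ∈ 𝓕, f X ⊆ X

/-- The function `(𝓕 ∪ id)^ω`; for continuous functions it yields the least relation that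
contains its argument and is closed under `𝓕`. -/
abbrev closure (𝓕 : Set RelFun) : RelFun := (famFun 𝓕).hat.omega

theorem RelFun.Continuous.exists_finite {f : RelFun} (hf : f.Continuous) {R : PRel}
    {pq : Prog × Prog} (h : pq ∈ f R) : ∃ S : PRel, S.Finite ∧ S ⊆ R ∧ pq ∈ f S := by
  rw [hf R] at h
  simp only [Set.mem_iUnion] at h
  obtain ⟨S, ⟨h1, h2⟩, h3⟩ := h
  exact ⟨S, h1, h2, h3⟩

theorem RelFun.Continuous.monotone {f : RelFun} (hf : f.Continuous) : Monotone f := by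
  intro R R' hR pq h
  obtain ⟨S, hS, hSR, hpq⟩ := hf.exists_finite h
  rw [hf R']
  exact Set.mem_biUnion (x := S) ⟨hS, hSR.trans hR⟩ hpq

theorem RelFun.continuous_of_exists {f : RelFun} (hm : Monotone f)
    (h : ∀ R, ∀ pq ∈ f R, ∃ S : PRel, S.Finite ∧ S ⊆ R ∧ pq ∈ f S) : f.Continuous := by
  intro R
  refine Set.Subset.antisymm (fun pq hpq => ?_) (Set.iUnion₂_subset fun S hS => hm hS.2)
  obtain ⟨S, h1, h2, h3⟩ := h R pq hpq
  exact Set.mem_biUnion (x := S) ⟨h1, h2⟩ h3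

theorem exists_subset_of_finite {X : ℕ → PRel} (hX : Monotone X) {S : PRel} (hS : S.Finite)
    (h : S ⊆ ⋃ n, X n) : ∃ n, S ⊆ X n := by
  induction S, hS using Set.Finite.induction_on with
  | empty => exact ⟨0, Set.empty_subset _⟩
  | @insert a S _ _ ih =>
    obtain ⟨n, hn⟩ := ih ((Set.subset_insert a S).trans h)
    obtain ⟨m, hm⟩ := Set.mem_iUnion.1 (h (Set.mem_insert a S))
    refine ⟨max n m, Set.insert_subset (hX (le_max_right n m) hm) ?_⟩
    exact hn.trans (hX (le_max_left n m))

theorem closedUnder_iUnion {𝓕 : Set RelFun} (h𝓕 : ∀ f ∈ 𝓕, f.Continuous) {X : ℕ → PRel}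
    (hX : Monotone X) (h : ∀ f ∈ 𝓕, ∀ n, f (X n) ⊆ X (n + 1)) : ClosedUnder 𝓕 (⋃ n, X n) := by
  intro f hf pq hpq
  obtain ⟨S, hS, hSX, hpqS⟩ := (h𝓕 f hf).exists_finite hpq
  obtain ⟨n, hn⟩ := exists_subset_of_finite hX hS hSX
  exact Set.mem_iUnion.2 ⟨n + 1, h f hf n ((h𝓕 f hf).monotone hn hpqS)⟩

theorem subset_closure (𝓕 : Set RelFun) (R : PRel) : R ⊆ closure 𝓕 R :=
  Set.subset_iUnion (fun n => ((famFun 𝓕).hat^[n]) R) 0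

theorem closedUnder_closure {𝓕 : Set RelFun} (h𝓕 : ∀ f ∈ 𝓕, f.Continuous) (R : PRel) :
    ClosedUnder 𝓕 (closure 𝓕 R) := by
  refine closedUnder_iUnion h𝓕 (monotone_nat_of_le_succ fun n => ?_) (fun f hf n => ?_) <;>
  rw [Function.iterate_succ_apply']
  · exact Set.subset_union_right
  · exact (Set.subset_biUnion_of_mem (u := fun f : RelFun => f _) hf).trans
      Set.subset_union_left

theorem closure_subset {𝓕 : Set RelFun} (h𝓕 : ∀ f ∈ 𝓕, f.Continuous) {R X : PRel}
    (hRX : R ⊆ X) (hX : ClosedUnder 𝓕 X) : closure 𝓕 R ⊆ X := by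
  refine Set.iUnion_subset fun n => ?_
  induction n with
  | zero => exact hRX
  | succ n ih =>
    rw [Function.iterate_succ_apply']
    exact Set.union_subset
      (Set.iUnion₂_subset fun f hf => ((h𝓕 f hf).monotone ih).trans (hX f hf)) ih

theorem closure_mono {𝓕 𝓖 : Set RelFun} (h𝓖 : ∀ f ∈ 𝓖, f.Continuous) (h : 𝓕 ⊆ 𝓖)
    {R S : PRel} (hRS : R ⊆ S) : closure 𝓕 R ⊆ closure 𝓖 S :=
  closure_subset (fun f hf => h𝓖 f (h hf)) (hRS.trans (subset_closure 𝓖 S))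
    fun f hf => closedUnder_closure h𝓖 S f (h hf)

theorem ClosedUnder.closure_eq {𝓕 : Set RelFun} (h𝓕 : ∀ f ∈ 𝓕, f.Continuous) {X : PRel}
    (hX : ClosedUnder 𝓕 X) : closure 𝓕 X = X :=
  (closure_subset h𝓕 subset_rfl hX).antisymm (subset_closure 𝓕 X)

/-- The function by which the passive side of a technique in `𝓕` may evolve. -/
abbrev sandwich (𝓕 𝓢 : Set RelFun) : RelFun := closure 𝓢 ∘ (famFun 𝓕).hat ∘ closure 𝓢

theorem sandwich_subset {𝓕 𝓢 : Set RelFun} (h𝓕 : ∀ f ∈ 𝓕, f.Continuous) (h : 𝓢 ⊆ 𝓕)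
    {R X : PRel} (hRX : R ⊆ X) (hX : ClosedUnder 𝓕 X) : sandwich 𝓕 𝓢 R ⊆ X := by
  have hS : ∀ {Y : PRel}, Y ⊆ X → closure 𝓢 Y ⊆ X := fun hY =>
    closure_subset (fun f hf => h𝓕 f (h hf)) hY fun f hf => hX f (h hf)
  exact hS (Set.union_subset
    (Set.iUnion₂_subset fun f hf => ((h𝓕 f hf).monotone (hS hRX)).trans (hX f hf)) (hS hRX))

theorem IsStrongPart.progress_closure {𝓕 𝓢 : Set RelFun} (h𝓕 : ∀ f ∈ 𝓕, f.Continuous)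
    (h : IsStrongPart 𝓕 𝓢) {R S T : PRel} (hR : Progress R S T) :
    Progress (closure 𝓢 R) (closure 𝓢 S) (closure 𝓕 T) := by
  have h𝓢 : ∀ f ∈ 𝓢, f.Continuous := fun f hf => h𝓕 f (h.subset hf)
  have hST : closure 𝓢 S ⊆ closure 𝓕 T := closure_mono h𝓕 h.subset hR.passive_sub
  have key : ∀ n, Progress (((famFun 𝓢).hat^[n]) R) (closure 𝓢 S) (closure 𝓕 T) := by
    intro n
    induction n with
    | zero => exact hR.mono (subset_closure 𝓢 S) (subset_closure 𝓕 T) hST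
    | succ n ih =>
      rw [Function.iterate_succ_apply']
      refine Progress.union ?_ ih
      have := Progress.iUnion (T := closure 𝓕 T) (S := fun _ : 𝓢 => closure 𝓢 S)
        (R := fun f : 𝓢 => f.1 (((famFun 𝓢).hat^[n]) R)) fun f => by
          have : Progress _ (closure 𝓢 (closure 𝓢 S)) (closure 𝓕 (closure 𝓕 T)) :=
            h.strong f.1 f.2 _ _ _ ih
          rwa [(closedUnder_closure h𝓢 S).closure_eq h𝓢,
            (closedUnder_closure h𝓕 T).closure_eq h𝓕] at this
      rw [Set.iUnion_coe_set (s := 𝓢)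
        (f := fun f : 𝓢 => f.1 (((famFun 𝓢).hat^[n]) R))] at this
      exact this.mono (Set.iUnion_subset fun _ => subset_rfl) subset_rfl hST
  have := Progress.iUnion key
  exact this.mono (Set.iUnion_subset fun _ => subset_rfl) subset_rfl hST

theorem IsStrongPart.progress_sandwich {𝓕 𝓢 : Set RelFun} (h𝓕 : ∀ f ∈ 𝓕, f.Continuous)
    (h : IsStrongPart 𝓕 𝓢) {R T : PRel} (hT : ClosedUnder 𝓕 T) (hR : Progress R R T) :
    Progress (sandwich 𝓕 𝓢 R) (sandwich 𝓕 𝓢 R) T := by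
  have h𝓢 : ∀ f ∈ 𝓢, f.Continuous := fun f hf => h𝓕 f (h.subset hf)
  have hX := h.progress_closure h𝓕 hR
  rw [hT.closure_eq h𝓕] at hX
  have hidem : closure 𝓢 (sandwich 𝓕 𝓢 R) = sandwich 𝓕 𝓢 R :=
    (closedUnder_closure h𝓢 _).closure_eq h𝓢
  have hRT : sandwich 𝓕 𝓢 R ⊆ T :=
    sandwich_subset h𝓕 h.subset (hR.sub_passive.trans hR.passive_sub) hT
  have hsub : closure 𝓢 R ⊆ sandwich 𝓕 𝓢 R :=
    Set.subset_union_right.trans (subset_closure 𝓢 _)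
  have hf : ∀ f : 𝓕, Progress (f.1 (closure 𝓢 R)) (sandwich 𝓕 𝓢 R) T := fun f => by
    have : Progress _ (sandwich 𝓕 𝓢 (closure 𝓢 R)) (closure 𝓕 T) := h.regular f.1 f.2 _ _ hX
    simpa only [sandwich, Function.comp_apply, (closedUnder_closure h𝓢 R).closure_eq h𝓢,
      hT.closure_eq h𝓕] using this
  have hU : Progress ((famFun 𝓕).hat (closure 𝓢 R)) (sandwich 𝓕 𝓢 R) T := by
    refine Progress.union ?_ (hX.mono hsub subset_rfl hRT)
    have := Progress.iUnion hf
    rw [Set.iUnion_coe_set (s := 𝓕) (f := fun f : 𝓕 => f.1 (closure 𝓢 R))] at this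
    exact this.mono (Set.iUnion_subset fun _ => subset_rfl) subset_rfl hRT
  have := h.progress_closure h𝓕 hU
  rwa [hidem, hT.closure_eq h𝓕] at this

/-- Soundness: up-to techniques of a diacritically compatible set preserve bisimilarity. The
closure of bisimilarity is the union of the iterates of the sandwich function, each of which
progresses to itself passively and to the closure actively. -/
theorem IsStrongPart.closedUnder_bisim {𝓕 𝓢 : Set RelFun} (h𝓕 : ∀ f ∈ 𝓕, f.Continuous)
    (h : IsStrongPart 𝓕 𝓢) : ClosedUnder 𝓕 bisim := by
  set T := closure 𝓕 bisim with hTdef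
  have hT : ClosedUnder 𝓕 T := closedUnder_closure h𝓕 _
  let X : ℕ → PRel := fun n => ((sandwich 𝓕 𝓢)^[n]) bisim
  have hsucc : ∀ n, X (n + 1) = sandwich 𝓕 𝓢 (X n) := fun n =>
    Function.iterate_succ_apply' _ _ _
  have hprog : ∀ n, Progress (X n) (X n) T := by
    intro n
    induction n with
    | zero =>
      exact Progress.mono isBisim_bisim subset_rfl (subset_closure 𝓕 _) (subset_closure 𝓕 _)
    | succ n ih =>
      rw [hsucc]
      exact h.progress_sandwich h𝓕 hT ih
  have hmono : Monotone X := monotone_nat_of_le_succ fun n => by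
    rw [hsucc]
    exact (subset_closure 𝓢 (X n)).trans (Set.subset_union_right.trans (subset_closure 𝓢 _))
  have hclosed : ClosedUnder 𝓕 (⋃ n, X n) := by
    refine closedUnder_iUnion h𝓕 hmono fun f hf n => ?_
    rw [hsucc]
    refine ((h𝓕 f hf).monotone (subset_closure 𝓢 (X n))).trans
      (Set.Subset.trans ?_ (subset_closure 𝓢 _))
    exact (Set.subset_biUnion_of_mem (u := fun f : RelFun => f _) hf).trans
      Set.subset_union_left
  have hTX : T = ⋃ n, X n :=
    (closure_subset h𝓕 (Set.subset_iUnion X 0) hclosed).antisymm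
      (Set.iUnion_subset fun n => (hprog n).passive_sub)
  have hbisim : IsBisim T := by
    have := Progress.iUnion hprog
    rwa [← hTX] at this
  have hTb : T = bisim := (subset_bisim hbisim).antisymm (subset_closure 𝓕 _)
  exact hTb ▸ hT

/-! ### Tests under relations closed under the techniques -/

/-- The techniques other than substitution of program contexts. -/
def strongTechniques : Set RelFun := {utRefl, utResult, utAbort, utLam, utSubstV, utRed}

theorem strongTechniques_subset : strongTechniques ⊆ techniques := by
  intro f hf
  simp only [strongTechniques, techniques, Set.mem_insert_iff, Set.mem_singleton_iff] at hf ⊢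
  tauto

theorem ClosedUnder.refl_mem {X : PRel} (hX : ClosedUnder strongTechniques X)
    (p : Prog) : (p, p) ∈ X :=
  hX utRefl (by simp [strongTechniques]) ⟨p, rfl⟩

theorem ClosedUnder.substV_mem {X : PRel} (hX : ClosedUnder strongTechniques X)
    {p q : Prog} {x : Var} {v w : Tm} (hpq : (p, q) ∈ X)
    (hv : v.IsVal) (hw : w.IsVal) (hvw : TestVal X v w) : (p.subst x v, q.subst x w) ∈ X :=
  hX utSubstV (by simp [strongTechniques]) ⟨p, q, x, v, w, hpq, hv, hw, hvw, rfl⟩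

theorem ClosedUnder.red_mem {X : PRel} (hX : ClosedUnder strongTechniques X)
    {p p' q q' : Prog} (hp : Reds p p') (hq : Reds q q')
    (h : (p', q') ∈ X) : (p, q) ∈ X :=
  hX utRed (by simp [strongTechniques]) ⟨p', q', hp, hq, h⟩

theorem ClosedUnder.testCtx_refl {X : PRel} (hX : ClosedUnder strongTechniques X)
    (F : PCtx) : TestCtx X F F := by
  obtain ⟨x, hx⟩ := F.finite_fv.exists_notMem
  exact ⟨x, hx, hx, hX.refl_mem _⟩

theorem ClosedUnder.testVal_refl {X : PRel} (hX : ClosedUnder strongTechniques X)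
    (v : Tm) : TestVal X v v := by
  obtain ⟨x, hx⟩ := v.finite_fv.exists_notMem
  obtain ⟨c, hc⟩ := (Tm.app v (.var x)).finite_fk.exists_notMem
  exact ⟨x, hx, hx, c, hc, hc, hX.refl_mem _⟩

/-- Related values may be tested in every program context and with every argument: they are
substituted for the variable `z` of the reflexive pair `F[z a]`. This renames the context
variable of the test without substitution of program contexts. -/
theorem ClosedUnder.plug_app_mem {X : PRel} (hX : ClosedUnder strongTechniques X)
    {v w : Tm} (hv : v.IsVal) (hw : w.IsVal)
    (hvw : TestVal X v w) (F : PCtx) (a : Tm) :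
    (F.plug (.app v a), F.plug (.app w a)) ∈ X := by
  obtain ⟨z, hz⟩ := (F.finite_fv.union a.finite_fv).exists_notMem
  have hzF : z ∉ F.fv := fun h => hz (Or.inl h)
  have hza : z ∉ a.fv := fun h => hz (Or.inr h)
  have h := hX.substV_mem (x := z) (hX.refl_mem (F.plug (.app (.var z) a))) hv hw hvw
  rwa [PCtx.plug_subst _ _ _ hv, PCtx.plug_subst _ _ _ hw, PCtx.subst_of_notMem hzF,
    PCtx.subst_of_notMem hzF, Tm.subst_app, Tm.subst_app, Tm.subst_of_notMem hza,
    Tm.subst_of_notMem hza, Tm.subst_var_self, Tm.subst_var_self] at h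

theorem ClosedUnder.plug_mem {X : PRel} (hX : ClosedUnder strongTechniques X)
    {F F' : PCtx} (h : TestCtx X F F') {v w : Tm} (hv : v.IsVal)
    (hw : w.IsVal) (hvw : TestVal X v w) : (F.plug v, F'.plug w) ∈ X := by
  obtain ⟨x, hx, hx', h⟩ := h
  have := hX.substV_mem (x := x) h hv hw hvw
  rwa [PCtx.plug_var_subst hx hv, PCtx.plug_var_subst hx' hw] at this

theorem testVal_of_forall {X : PRel} {v w : Tm} {A B : Set ℕ} (hA : A.Finite) (hB : B.Finite)
    (h : ∀ c ∉ A, ∀ y ∉ B, (Prog.inCtx c (.app v (.var y)), Prog.inCtx c (.app w (.var y))) ∈ X) :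
    TestVal X v w := by
  obtain ⟨y, hy⟩ := (hB.union (v.finite_fv.union w.finite_fv)).exists_notMem
  simp only [Set.mem_union, not_or] at hy
  obtain ⟨c, hc⟩ := (hA.union ((Tm.app v (.var y)).finite_fk.union
    (Tm.app w (.var y)).finite_fk)).exists_notMem
  simp only [Set.mem_union, not_or] at hc
  exact ⟨y, hy.2.1, hy.2.2, c, hc.2.1, hc.2.2, h c hc.1 y hy.1⟩

theorem testCtx_of_forall {X : PRel} {F F' : PCtx} {B : Set ℕ} (hB : B.Finite)
    (h : ∀ y ∉ B, (F.plug (.var y), F'.plug (.var y)) ∈ X) : TestCtx X F F' := by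
  obtain ⟨y, hy⟩ := (hB.union (F.finite_fv.union F'.finite_fv)).exists_notMem
  simp only [Set.mem_union, not_or] at hy
  exact ⟨y, hy.2.1, hy.2.2, h y hy.1⟩

theorem Prog.subst_inCtx (c : CVar) (t : Tm) (x : Var) (v : Tm) :
    (Prog.inCtx c t).subst x v = .inCtx c (t.subst x v) := rfl

theorem Prog.substc_inCtx_self (c : CVar) (t : Tm) (F : PCtx) :
    (Prog.inCtx c t).substc c F = F.plug (t.substc c F) := if_pos rfl

theorem Prog.substc_inCtx_of_ne {c d : CVar} (h : d ≠ c) (t : Tm) (F : PCtx) :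
    (Prog.inCtx d t).substc c F = .inCtx d (t.substc c F) :=
  if_neg fun h' => h (Option.some_injective _ h')

theorem ClosedUnder.testVal_subst {X : PRel} (hX : ClosedUnder strongTechniques X)
    {a b v w : Tm} (ha : a.IsVal) (hb : b.IsVal) (hab : TestVal X a b) (hv : v.IsVal)
    (hw : w.IsVal) (hvw : TestVal X v w) (x : Var) :
    TestVal X (a.subst x v) (b.subst x w) := by
  refine testVal_of_forall Set.finite_empty (Set.finite_singleton x) fun c _ y hy => ?_
  have := hX.substV_mem (x := x) (hX.plug_app_mem ha hb hab ⟨some c, .hole⟩ (.var y)) hv hw hvw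
  rwa [PCtx.plug_subst _ _ _ hv, PCtx.plug_subst _ _ _ hw, Tm.subst_app, Tm.subst_app,
    Tm.subst_var_of_ne hy, Tm.subst_var_of_ne hy] at this

theorem ClosedUnder.testCtx_subst {X : PRel} (hX : ClosedUnder strongTechniques X)
    {F F' : PCtx} {v w : Tm} (hF : TestCtx X F F') (hv : v.IsVal)
    (hw : w.IsVal) (hvw : TestVal X v w) (x : Var) :
    TestCtx X (F.subst x v hv) (F'.subst x w hw) := by
  refine testCtx_of_forall (Set.finite_singleton x) fun y hy => ?_
  have := hX.substV_mem (x := x)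
    (hX.plug_mem hF (v := .var y) (w := .var y) trivial trivial (hX.testVal_refl _)) hv hw hvw
  rwa [PCtx.plug_subst _ _ _ hv, PCtx.plug_subst _ _ _ hw, Tm.subst_var_of_ne hy,
    Tm.subst_var_of_ne hy] at this

theorem substC_mem {X Z : PRel} (h : utSubstC X ⊆ Z) {p q : Prog} {F F' : PCtx}
    (hpq : (p, q) ∈ X) (hF : TestCtx X F F') (c : CVar) :
    (p.substc c F, q.substc c F') ∈ Z :=
  h ⟨p, q, c, F, F', hpq, hF, rfl⟩

theorem ClosedUnder.testVal_substc {X Z : PRel} (hX : ClosedUnder strongTechniques X)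
    (h : utSubstC X ⊆ Z) {a b : Tm} (ha : a.IsVal) (hb : b.IsVal) (hab : TestVal X a b)
    {F F' : PCtx} (hF : TestCtx X F F') (c : CVar) :
    TestVal Z (a.substc c F) (b.substc c F') := by
  refine testVal_of_forall (Set.finite_singleton c) Set.finite_empty fun d hd y _ => ?_
  have := substC_mem h (hX.plug_app_mem ha hb hab ⟨some d, .hole⟩ (.var y)) hF c
  exact (Prog.substc_inCtx_of_ne hd (.app a (.var y)) F) ▸
    (Prog.substc_inCtx_of_ne hd (.app b (.var y)) F') ▸ this

theorem ClosedUnder.testCtx_substc {X Z : PRel} (hX : ClosedUnder strongTechniques X)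
    (h : utSubstC X ⊆ Z) {G G' F F' : PCtx} (hG : TestCtx X G G') (hF : TestCtx X F F')
    (c : CVar) : TestCtx Z (G.substc c F) (G'.substc c F') := by
  refine testCtx_of_forall Set.finite_empty fun y _ => ?_
  have := substC_mem h (hX.plug_mem hG (v := .var y) (w := .var y) trivial trivial
    (hX.testVal_refl _)) hF c
  rwa [PCtx.plug_substc, PCtx.plug_substc] at this

/-! ### Substitution in matching programs -/

theorem ClosedUnder.strong {X : PRel} (hX : ClosedUnder techniques X) :
    ClosedUnder strongTechniques X := fun f hf => hX f (strongTechniques_subset hf)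

theorem ClosedUnder.substC_subset {X : PRel} (hX : ClosedUnder techniques X) :
    utSubstC X ⊆ X := hX utSubstC (by simp [techniques])

/-- Matching is stable under substitution of values. When the left program is stuck on the
substituted variable, the substitution creates an application of the substituted value, which
is matched by assumption `happ`. -/
theorem Matches.subst {S T S' T' : PRel} {p q : Prog} (h : Matches S T p q) (hT : T ⊆ T')
    (hT' : ClosedUnder strongTechniques T') {x : Var} {v w : Tm} (hv : v.IsVal) (hw : w.IsVal)
    (hvw : TestVal T' v w)
    (hS : ∀ c a b, p = .inCtx c a → a.IsVal → b.IsVal → TestVal S a b →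
      TestVal S' (a.subst x v) (b.subst x w))
    (happ : ∀ G G' F b b' a, p = PCtx.plug F (.app (.var x) a) → a.IsVal → b.IsVal → b'.IsVal →
      TestCtx T' G G' → TestVal T' b b' →
      Matches S' T' (G.plug (.app v b)) (G'.plug (.app w b'))) :
    Matches S' T' (p.subst x v) (q.subst x w) := by
  cases h with
  | red h hq ht =>
    exact .red (h.subst x hv) (hq.subst x hw) (hT'.substV_mem (hT ht) hv hw hvw)
  | val ha hb hq => exact .val (ha.subst hv x) (hb.subst hw x) (hq.subst x hw)
  | @stuck F F' z a b _ ha hb hq hF hab =>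
    have hF₁ := hT'.testCtx_subst (hF.mono hT) hv hw hvw x
    have hab₁ := hT'.testVal_subst ha hb (hab.mono hT) hv hw hvw x
    have hq₁ := hq.subst x hw
    rw [PCtx.plug_subst _ _ _ hw, Tm.subst_app] at hq₁
    rw [PCtx.plug_subst _ _ _ hv, Tm.subst_app]
    by_cases hz : z = x
    · subst hz
      rw [Tm.subst_var_self] at hq₁ ⊢
      exact .of_reds hq₁
        (happ _ _ F _ _ a rfl ha (ha.subst hv z) (hb.subst hw z) hF₁ hab₁)
    · rw [Tm.subst_var_of_ne hz] at hq₁ ⊢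
      exact .stuck (ha.subst hv x) (hb.subst hw x) hq₁ hF₁ hab₁
  | ctxVal ha hb hq hab =>
    exact .ctxVal (ha.subst hv x) (hb.subst hw x) (hq.subst x hw) (hS _ _ _ rfl ha hb hab)

/-- Matching is stable under substitution of program contexts. When the left program is a value
in the substituted context variable, the substitution puts this value into a program context,
which is matched by assumption `hc`. -/
theorem Matches.substc {S T S' T' : PRel} {p q : Prog} (h : Matches S T p q) (hT : T ⊆ T')
    (hT' : ClosedUnder techniques T') {c : CVar} {F F' : PCtx} (hF : TestCtx T' F F')
    (hS : ∀ d a b, p = .inCtx d a → a.IsVal → b.IsVal → TestVal S a b →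
      TestVal S' (a.substc c F) (b.substc c F'))
    (hc : ∀ a b, p = .inCtx c a → a.IsVal → b.IsVal → TestVal S a b →
      Matches S' T' (F.plug (a.substc c F)) (F'.plug (b.substc c F'))) :
    Matches S' T' (p.substc c F) (q.substc c F') := by
  cases h with
  | red h hq ht =>
    exact .red (h.substc c F) (hq.substc c F') (substC_mem hT'.substC_subset (hT ht) hF c)
  | val ha hb hq => exact .val (ha.substc c F) (hb.substc c F') (hq.substc c F')
  | stuck ha hb hq hG hab =>
    have hG₁ := hT'.strong.testCtx_substc hT'.substC_subset (hG.mono hT) hF c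
    have hab₁ := hT'.strong.testVal_substc hT'.substC_subset ha hb (hab.mono hT) hF c
    have hq₁ := hq.substc c F'
    rw [PCtx.plug_substc] at hq₁ ⊢
    exact .stuck (ha.substc c F) (hb.substc c F') hq₁ hG₁ hab₁
  | @ctxVal d a b _ ha hb hq hab =>
    have hq₁ := hq.substc c F'
    by_cases hd : d = c
    · subst hd
      rw [Prog.substc_inCtx_self] at hq₁ ⊢
      exact .of_reds hq₁ (hc _ _ rfl ha hb hab)
    · rw [Prog.substc_inCtx_of_ne hd] at hq₁ ⊢
      exact .ctxVal (ha.substc c F) (hb.substc c F') hq₁ (hS _ _ _ rfl ha hb hab)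

/-- Applications of related values match in related contexts and with related arguments, even
after a substitution of program contexts in the values. The relation at passive positions is
arbitrary, because such an application is never passive. This is obtained from the test
`d[u y] R d[u' y]` by renaming `y` and `d`, then substituting `F` for `c`, the surrounding
context for `d`, and the argument for `y`. -/
theorem Progress.matches_app {R S T S' T' : PRel} (hR : Progress R S T) (hT : T ⊆ T')
    (hT' : ClosedUnder techniques T') {u u' : Tm} (hu : u.IsVal)
    (huu : TestVal R u u') {F F' : PCtx} (hF : TestCtx T' F F') (c : CVar)
    {G G' : PCtx} (hG : TestCtx T' G G') {b b' : Tm} (hb : b.IsVal) (hb' : b'.IsVal)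
    (hbb : TestVal T' b b') :
    Matches S' T' (G.plug (.app (u.substc c F) b)) (G'.plug (.app (u'.substc c F') b')) := by
  obtain ⟨y, hyu, hyu', d, hdu, hdu', h⟩ := huu
  replace hdu : d ∉ u.fk := fun h => hdu (Or.inl h)
  replace hdu' : d ∉ u'.fk := fun h => hdu' (Or.inl h)
  obtain ⟨z, hz⟩ := (((u.substc c F).finite_fv.union (u'.substc c F').finite_fv).union
    (G.finite_fv.union G'.finite_fv)).exists_notMem
  obtain ⟨e, he⟩ := (((u.substc c F).finite_fk.union (u'.substc c F').finite_fk).union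
    (Set.finite_singleton c)).exists_notMem
  simp only [Set.mem_union, Set.mem_singleton_iff, not_or] at hz he
  obtain ⟨⟨hzu, hzu'⟩, hzG, hzG'⟩ := hz
  obtain ⟨⟨heu, heu'⟩, hec⟩ := he
  have hs := hT'.strong
  -- The programs in the chain below are applications in a context variable, hence not passive.
  have happ : ∀ {k k' : CVar} {t s a : Tm}, Prog.inCtx k (.app t s) = .inCtx k' a →
      a.IsVal → False := by
    intro k k' t s a h ha
    cases h
    exact ha
  have m₀ : Matches S T (.inCtx d (.app u (.var y))) (.inCtx d (.app u' (.var y))) :=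
    hR.matches h
  have m₁ := m₀.subst (S' := S') hT hs (x := y) (v := .var z) (w := .var z) trivial trivial
    (hs.testVal_refl _) (fun _ _ _ hp ha => (happ hp ha).elim)
    (fun _ _ _ _ _ _ _ _ hb hb' hG hbb => .stuck hb hb' .refl hG hbb)
  simp only [Prog.subst_inCtx, Tm.subst_app, Tm.subst_of_notMem hyu, Tm.subst_of_notMem hyu',
    Tm.subst_var_self] at m₁
  have m₂ := m₁.substc (S' := S') subset_rfl hT' (c := d) (hs.testCtx_refl ⟨some e, .hole⟩)
    (fun _ _ _ hp ha => (happ hp ha).elim) (fun _ _ hp ha => (happ hp ha).elim)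
  simp only [Prog.substc_inCtx_self, Tm.substc, Tm.substc_of_notMem hdu,
    Tm.substc_of_notMem hdu'] at m₂
  change Matches S' T' (.inCtx e (.app u (.var z))) (.inCtx e (.app u' (.var z))) at m₂
  have m₃ := m₂.substc (S' := S') subset_rfl hT' (c := c) hF
    (fun _ _ _ hp ha => (happ hp ha).elim) (fun _ _ hp ha => (happ hp ha).elim)
  simp only [Prog.substc_inCtx_of_ne hec, Tm.substc] at m₃
  have m₄ := m₃.substc (S' := S') subset_rfl hT' (c := e) hG
    (fun _ _ _ hp ha => (happ hp ha).elim) (fun _ _ hp ha => (happ hp ha).elim)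
  simp only [Prog.substc_inCtx_self, Tm.substc, Tm.substc_of_notMem heu,
    Tm.substc_of_notMem heu'] at m₄
  have hfocus : (Tm.app (u.substc c F) (.var z)).IsFocus := ⟨hu.substc c F, trivial⟩
  have m₅ := m₄.subst (S' := S') subset_rfl hs (x := z) hb hb' hbb
    (fun _ _ _ hp ha => (G.ectx.not_isVal_plug hfocus
      (by rw [show G.ectx.plug _ = _ from congrArg Prog.body hp]; exact ha)).elim)
    (fun _ _ F₁ _ _ a hp ha _ _ _ _ => by
      -- The focus `u[F/c] z` could be stuck on `z` only if `z` occurred in `u[F/c]`.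
      obtain ⟨-, hfoc⟩ := PCtx.plug_inj hfocus (isFocus_stuck ha) hp
      simp only [Tm.app.injEq] at hfoc
      rw [hfoc.1] at hzu
      exact (hzu rfl).elim)
  rwa [PCtx.plug_subst _ _ _ hb, PCtx.plug_subst _ _ _ hb', PCtx.subst_of_notMem hzG,
    PCtx.subst_of_notMem hzG', Tm.subst_app, Tm.subst_app, Tm.subst_of_notMem hzu,
    Tm.subst_of_notMem hzu', Tm.subst_var_self, Tm.subst_var_self] at m₅

/-! ### Evolution of the techniques -/

theorem ClosedUnder.matches_refl {S T : PRel} (hS : ClosedUnder strongTechniques S)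
    (hT : ClosedUnder strongTechniques T) (p : Prog) : Matches S T p p := by
  rcases p.classify with ⟨v, hv, rfl⟩ | ⟨c, v, hv, rfl⟩ | ⟨F, x, v, hv, rfl⟩ | ⟨p', hp⟩
  · exact .val hv hv .refl
  · exact .ctxVal hv hv .refl (hS.testVal_refl v)
  · exact .stuck hv hv .refl (hT.testCtx_refl F) (hT.testVal_refl v)
  · exact .red hp (.single hp) (hT.refl_mem p')

/-- One half of strong evolution, with the closures generalised to arbitrary closed
relations. -/
theorem Progress.matches_strong {R S T S' T' : PRel} (hR : Progress R S T) (hSS : S ⊆ S')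
    (hS' : ClosedUnder strongTechniques S') (hTT : T ⊆ T') (hT' : ClosedUnder techniques T')
    {f : RelFun} (hf : f ∈ strongTechniques) {p q : Prog} (hpq : (p, q) ∈ f R) :
    Matches S' T' p q := by
  have hs := hT'.strong
  have hRT : R ⊆ T' := hR.sub_passive.trans (hR.passive_sub.trans hTT)
  have hRS : R ⊆ S' := hR.sub_passive.trans hSS
  simp only [strongTechniques, Set.mem_insert_iff, Set.mem_singleton_iff] at hf
  rcases hf with rfl | rfl | rfl | rfl | rfl | rfl
  · obtain ⟨r, hr⟩ := hpq
    obtain ⟨rfl, rfl⟩ := Prod.mk.inj hr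
    exact hS'.matches_refl hs _
  · obtain ⟨v, w, hv, hw, hr⟩ := hpq
    cases hr
    exact .val hv hw .refl
  · obtain ⟨c, p', q', h, hr⟩ := hpq
    cases hr
    exact .red (.abort ⟨some c, .hole⟩ p') (.single (.abort ⟨some c, .hole⟩ q')) (hRT h)
  · obtain ⟨c, x, t, s, ⟨d, hdt, hds, h⟩, hr⟩ := hpq
    cases hr
    -- The abstractions are tested with the variable that they bind.
    refine .ctxVal (v := Tm.abs x t) (w := Tm.abs x s) trivial trivial .refl
      ⟨x, Tm.notMem_fv_abs x t, Tm.notMem_fv_abs x s, d, ?_, ?_, ?_⟩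
    · simpa [Tm.fk, Tm.abs, Tm.fk_rename] using hdt
    · simpa [Tm.fk, Tm.abs, Tm.fk_rename] using hds
    · have hβ : ∀ t, Reds (.inCtx d (.app (Tm.abs x t) (.var x))) (.inCtx d t) := fun t => by
        have := Red.beta ⟨some d, .hole⟩ (t.rename fun y => if y = x then 0 else y + 1)
          (.var x) trivial
        rw [Tm.beta_abs] at this
        exact .single this
      exact hS'.red_mem (hβ t) (hβ s) (hRS h)
  · obtain ⟨p', q', x, v, w, h, hv, hw, hvw, hr⟩ := hpq
    cases hr
    refine (hR.matches h).subst hTT hs hv hw (hvw.mono hRT)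
      (fun c a b _ ha hb hab =>
        hS'.testVal_subst ha hb (hab.mono hSS) hv hw (hvw.mono hRS) x) ?_
    intro G G' F b b' a _ _ hb hb' hG hbb
    obtain ⟨k, hk⟩ := (v.finite_fk.union w.finite_fk).exists_notMem
    have := hR.matches_app (S' := S') hTT hT' hv hvw (hs.testCtx_refl ⟨none, .hole⟩) k hG
      hb hb' hbb
    rwa [Tm.substc_of_notMem fun h => hk (Or.inl h),
      Tm.substc_of_notMem fun h => hk (Or.inr h)] at this
  · obtain ⟨p', q', hp, hq, h⟩ := hpq
    rcases Relation.ReflTransGen.cases_head hp with rfl | ⟨r, hr, hp⟩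
    · exact .of_reds hq ((hR.matches h).mono hSS hTT)
    · exact .red hr .refl (hs.red_mem hp hq (hRT h))

/-- One half of the evolution of substitution of program contexts. At the passive positions,
`X` collects the strong techniques used before the substitution, and `Z` those used after.
When a value `a` of the left program `c[a]` reaches the hole of `F`, the test `F[y]` of the
contexts is instantiated with `a[F/c]`. -/
theorem Progress.matches_substC {R T X Z T' : PRel} (hR : Progress R R T) (hRX : R ⊆ X)
    (hX : ClosedUnder strongTechniques X) (hXZ : X ⊆ Z) (hsub : utSubstC X ⊆ Z)
    (hZ : ClosedUnder strongTechniques Z) (hZT : Z ⊆ T') (hTT : T ⊆ T')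
    (hT' : ClosedUnder techniques T') {p q : Prog} (hpq : (p, q) ∈ utSubstC R) :
    Matches Z T' p q := by
  obtain ⟨p', q', c, F, F', h, hF, hr⟩ := hpq
  cases hr
  have hRT : R ⊆ T' := hR.passive_sub.trans hTT
  have hval : ∀ a b, a.IsVal → b.IsVal → TestVal R a b →
      TestVal Z (a.substc c F) (b.substc c F') := fun a b ha hb hab =>
    hX.testVal_substc hsub ha hb (hab.mono hRX) (hF.mono hRX) c
  refine (hR.matches h).substc hTT hT' (hF.mono hRT)
    (fun d a b _ ha hb hab => hval a b ha hb hab) ?_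
  intro a b _ ha hb hab
  have hab' := hval a b ha hb hab
  have hav := ha.substc c F
  have hbv := hb.substc c F'
  have hFR := hF.mono hRT
  obtain ⟨y, hy, hy', hF⟩ := hF
  have := (hR.matches hF).subst (S' := Z) hTT hT'.strong hav hbv (hab'.mono hZT)
    (fun d a₁ b₁ _ ha₁ hb₁ hab₁ =>
      hZ.testVal_subst ha₁ hb₁ (hab₁.mono (hRX.trans hXZ)) hav hbv hab' y)
    (fun G G' _ d d' _ _ _ hd hd' hG hdd => hR.matches_app hTT hT' ha hab hFR c hG hd hd' hdd)
  rwa [PCtx.plug_var_subst hy, PCtx.plug_var_subst hy'] at this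
  all_goals assumption

/-! ### Continuity and symmetry of the techniques -/

theorem TestTm.exists_pair {R : PRel} {t s : Tm} (h : TestTm R t s) :
    ∃ pq ∈ R, TestTm {pq} t s :=
  let ⟨c, h1, h2, h3⟩ := h
  ⟨_, h3, c, h1, h2, rfl⟩

theorem TestVal.exists_pair {R : PRel} {v w : Tm} (h : TestVal R v w) :
    ∃ pq ∈ R, TestVal {pq} v w :=
  let ⟨x, h1, h2, h3⟩ := h
  let ⟨pq, hpq, h4⟩ := h3.exists_pair
  ⟨pq, hpq, x, h1, h2, h4⟩

theorem TestCtx.exists_pair {R : PRel} {F F' : PCtx} (h : TestCtx R F F') :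
    ∃ pq ∈ R, TestCtx {pq} F F' :=
  let ⟨x, h1, h2, h3⟩ := h
  ⟨_, h3, x, h1, h2, rfl⟩

theorem monotone_of_mem_techniques {f : RelFun} (hf : f ∈ techniques) : Monotone f := by
  intro R R' hR pq h
  simp only [techniques, Set.mem_insert_iff, Set.mem_singleton_iff] at hf
  rcases hf with rfl | rfl | rfl | rfl | rfl | rfl | rfl
  · exact h
  · exact h
  · obtain ⟨c, p, q, h, rfl⟩ := h
    exact ⟨c, p, q, hR h, rfl⟩
  · obtain ⟨c, x, t, s, h, rfl⟩ := h
    exact ⟨c, x, t, s, h.mono hR, rfl⟩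
  · obtain ⟨p, q, x, v, w, h, hv, hw, hvw, rfl⟩ := h
    exact ⟨p, q, x, v, w, hR h, hv, hw, hvw.mono hR, rfl⟩
  · obtain ⟨p, q, c, F, F', h, hF, rfl⟩ := h
    exact ⟨p, q, c, F, F', hR h, hF.mono hR, rfl⟩
  · obtain ⟨p', q', hp, hq, h⟩ := h
    exact ⟨p', q', hp, hq, hR h⟩

theorem continuous_of_mem_techniques : ∀ f ∈ techniques, RelFun.Continuous f := by
  intro f hf
  refine RelFun.continuous_of_exists (monotone_of_mem_techniques hf) fun R pq h => ?_
  have one : ∀ a : Prog × Prog, a ∈ R → ({a} : PRel).Finite ∧ {a} ⊆ R := fun a ha =>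
    ⟨Set.finite_singleton a, Set.singleton_subset_iff.2 ha⟩
  have two : ∀ a b : Prog × Prog, a ∈ R → b ∈ R → ({a, b} : PRel).Finite ∧ {a, b} ⊆ R :=
    fun a b ha hb => ⟨Set.toFinite _, Set.insert_subset ha (Set.singleton_subset_iff.2 hb)⟩
  have sub : ∀ a b : Prog × Prog, ({b} : PRel) ⊆ {a, b} := fun a b => Set.subset_insert a {b}
  simp only [techniques, Set.mem_insert_iff, Set.mem_singleton_iff] at hf
  rcases hf with rfl | rfl | rfl | rfl | rfl | rfl | rfl
  · exact ⟨∅, Set.finite_empty, Set.empty_subset R, h⟩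
  · exact ⟨∅, Set.finite_empty, Set.empty_subset R, h⟩
  · obtain ⟨c, p, q, h, rfl⟩ := h
    exact ⟨_, (one _ h).1, (one _ h).2, c, p, q, rfl, rfl⟩
  · obtain ⟨c, x, t, s, h, rfl⟩ := h
    obtain ⟨a, ha, h⟩ := h.exists_pair
    exact ⟨_, (one _ ha).1, (one _ ha).2, c, x, t, s, h, rfl⟩
  · obtain ⟨p, q, x, v, w, h, hv, hw, hvw, rfl⟩ := h
    obtain ⟨a, ha, hvw⟩ := hvw.exists_pair
    exact ⟨_, (two _ _ h ha).1, (two _ _ h ha).2, p, q, x, v, w, Set.mem_insert _ _, hv, hw,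
      hvw.mono (sub _ _), rfl⟩
  · obtain ⟨p, q, c, F, F', h, hF, rfl⟩ := h
    obtain ⟨a, ha, hF⟩ := hF.exists_pair
    exact ⟨_, (two _ _ h ha).1, (two _ _ h ha).2, p, q, c, F, F', Set.mem_insert _ _,
      hF.mono (sub _ _), rfl⟩
  · obtain ⟨p', q', hp, hq, h⟩ := h
    exact ⟨_, (one _ h).1, (one _ h).2, p', q', hp, hq, rfl⟩

theorem continuous_of_mem_strongTechniques : ∀ f ∈ strongTechniques, RelFun.Continuous f :=
  fun f hf => continuous_of_mem_techniques f (strongTechniques_subset hf)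

theorem mem_swap_of_mem_techniques {f : RelFun} (hf : f ∈ techniques) {R : PRel} {p q : Prog}
    (h : (p, q) ∈ f R) : (q, p) ∈ f (swapRel R) := by
  simp only [techniques, Set.mem_insert_iff, Set.mem_singleton_iff] at hf
  rcases hf with rfl | rfl | rfl | rfl | rfl | rfl | rfl
  · obtain ⟨r, hr⟩ := h
    exact ⟨r, congrArg Prod.swap hr⟩
  · obtain ⟨v, w, hv, hw, hr⟩ := h
    exact ⟨w, v, hw, hv, congrArg Prod.swap hr⟩
  · obtain ⟨c, p, q, h, hr⟩ := h
    exact ⟨c, q, p, h, congrArg Prod.swap hr⟩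
  · obtain ⟨c, x, t, s, h, hr⟩ := h
    exact ⟨c, x, s, t, h.swap, congrArg Prod.swap hr⟩
  · obtain ⟨p, q, x, v, w, h, hv, hw, hvw, hr⟩ := h
    exact ⟨q, p, x, w, v, h, hw, hv, hvw.swap, congrArg Prod.swap hr⟩
  · obtain ⟨p, q, c, F, F', h, hF, hr⟩ := h
    exact ⟨q, p, c, F', F, h, hF.swap, congrArg Prod.swap hr⟩
  · obtain ⟨p', q', hp, hq, h⟩ := h
    exact ⟨q', p', hq, hp, h⟩

theorem ClosedUnder.swap {𝓕 : Set RelFun} (h𝓕 : 𝓕 ⊆ techniques) {X : PRel}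
    (hX : ClosedUnder 𝓕 X) : ClosedUnder 𝓕 (swapRel X) := fun f hf _ hpq =>
  hX f hf (mem_swap_of_mem_techniques (h𝓕 hf) hpq)

/-! ### Diacritical compatibility -/

theorem stronglyEvolves_of_mem {f : RelFun} (hf : f ∈ strongTechniques) :
    StronglyEvolves f (closure strongTechniques) (closure techniques) := by
  intro R S T hR
  have hft := strongTechniques_subset hf
  have hS := closedUnder_closure continuous_of_mem_strongTechniques S
  have hT := closedUnder_closure continuous_of_mem_techniques T
  refine .of_matches ?_ ?_ (fun p q hpq => ?_) (fun p q hpq => ?_)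
  · exact (monotone_of_mem_techniques hft
      (hR.sub_passive.trans (subset_closure strongTechniques S))).trans (hS f hf)
  · exact closure_mono continuous_of_mem_techniques strongTechniques_subset hR.passive_sub
  · exact hR.matches_strong (subset_closure _ S) hS (subset_closure _ T) hT hf hpq
  · exact hR.swap.matches_strong (swapRel_mono (subset_closure _ S))
      (hS.swap strongTechniques_subset) (swapRel_mono (subset_closure _ T))
      (hT.swap subset_rfl) hf (mem_swap_of_mem_techniques hft hpq)

theorem evolves_substC :
    Evolves utSubstC (sandwich techniques strongTechniques) (closure techniques) := by
  intro R T hR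
  have hmem : utSubstC ∈ techniques := by simp [techniques]
  set X := closure strongTechniques R with hXdef
  set Z := sandwich techniques strongTechniques R with hZdef
  set T' := closure techniques T with hTdef
  have hRX : R ⊆ X := subset_closure _ R
  have hX : ClosedUnder strongTechniques X :=
    closedUnder_closure continuous_of_mem_strongTechniques R
  have hZ : ClosedUnder strongTechniques Z :=
    closedUnder_closure continuous_of_mem_strongTechniques _
  have hTT : T ⊆ T' := subset_closure _ T
  have hT' : ClosedUnder techniques T' := closedUnder_closure continuous_of_mem_techniques T
  have hXZ : X ⊆ Z := Set.subset_union_right.trans (subset_closure strongTechniques _)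
  have hsub : utSubstC X ⊆ Z :=
    ((Set.subset_biUnion_of_mem (u := fun f : RelFun => f X) hmem).trans
      Set.subset_union_left).trans (subset_closure strongTechniques _)
  have hZT : Z ⊆ T' := sandwich_subset continuous_of_mem_techniques strongTechniques_subset
    (hR.passive_sub.trans hTT) hT'
  refine .of_matches ((monotone_of_mem_techniques hmem hRX).trans hsub) hZT
    (fun p q hpq => ?_) (fun p q hpq => ?_)
  · exact hR.matches_substC hRX hX hXZ hsub hZ hZT hTT hT' hpq
  · exact hR.swap.matches_substC (swapRel_mono hRX)
      (hX.swap strongTechniques_subset) (swapRel_mono hXZ)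
      (fun x hx => hsub (mem_swap_of_mem_techniques hmem (p := x.1) (q := x.2) hx))
      (hZ.swap strongTechniques_subset) (swapRel_mono hZT) (swapRel_mono hTT)
      (hT'.swap subset_rfl) (mem_swap_of_mem_techniques hmem hpq)

theorem isStrongPart_strongTechniques : IsStrongPart techniques strongTechniques where
  subset := strongTechniques_subset
  strong _ hf := stronglyEvolves_of_mem hf
  regular f hf := by
    by_cases hs : f ∈ strongTechniques
    · intro R T hR
      have hRT := hR.passive_sub.trans (subset_closure techniques T)
      exact (stronglyEvolves_of_mem hs R R T hR).mono
        (Set.subset_union_right.trans (subset_closure strongTechniques _)) subset_rfl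
        (sandwich_subset continuous_of_mem_techniques strongTechniques_subset hRT
          (closedUnder_closure continuous_of_mem_techniques T))
    · have : f = utSubstC := by
        simp only [techniques, strongTechniques, Set.mem_insert_iff,
          Set.mem_singleton_iff] at hf hs
        tauto
      subst this
      exact evolves_substC

/-- Substitution of program contexts does not evolve strongly to anything. The relation below
consists of `c[x₁]`, `c[x₂]` and of `c[x₀ x₃]` paired with itself, with a passive test of `x₁`
against `x₂` that may be arbitrary. Substituting `c[[] x₃]` for `c` yields `c[x₁ x₃]` and
`c[x₂ x₃]`, which are stuck on distinct variables. -/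
theorem not_stronglyEvolves_substC (g h : RelFun) : ¬ StronglyEvolves utSubstC g h := by
  intro H
  let F : PCtx := ⟨some 0, .appL .hole (.var 3)⟩
  let R : PRel := {(.inCtx 0 (.var 1), .inCtx 0 (.var 2)), (F.plug (.var 0), F.plug (.var 0))}
  have huniv : ClosedUnder strongTechniques Set.univ := fun _ _ => Set.subset_univ _
  have hval : ∀ v w, TestVal Set.univ v w := fun v w =>
    testVal_of_forall Set.finite_empty Set.finite_empty fun _ _ _ _ => trivial
  have hvar : ∀ x y c, Matches Set.univ Set.univ (.inCtx c (.var x)) (.inCtx c (.var y)) :=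
    fun x y c => .ctxVal (v := .var x) (w := .var y) trivial trivial .refl (hval _ _)
  have hself : ∀ p, Matches Set.univ Set.univ p p := huniv.matches_refl huniv
  have hR : Progress R Set.univ Set.univ := by
    refine .of_matches (Set.subset_univ _) subset_rfl (fun p q hpq => ?_) (fun p q hpq => ?_)
    · rcases hpq with hpq | hpq <;> cases hpq
      · exact hvar _ _ _
      · exact hself _
    · refine Matches.mono (S := Set.univ) (T := Set.univ) (fun _ _ => trivial)
        (fun _ _ => trivial) ?_
      rcases hpq with hpq | hpq <;> cases hpq
      · exact hvar _ _ _
      · exact hself _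
  have hF : TestCtx R F F := by
    have h0 : (0 : Var) ∉ F.fv := by simp [F, PCtx.fv, ECtx.fv, Tm.fv]
    exact ⟨0, h0, h0, Or.inr rfl⟩
  have hmem : (F.plug (.var 1), F.plug (.var 2)) ∈ utSubstC R :=
    ⟨_, _, 0, F, F, Or.inl rfl, hF, by simp only [Prog.substc_inCtx_self, Tm.substc]⟩
  have hm := (H R Set.univ Set.univ hR).matches hmem
  obtain ⟨F', w, hw, he, -⟩ :=
    Matches.stuck_left (F := ⟨some 0, .hole⟩) (x := 1) (v := .var 3) hm trivial
  have heq := he.1.eq_of_normal fun r =>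
    not_red_stuck (F := ⟨some 0, .hole⟩) (x := 2) (v := .var 3) trivial
  obtain ⟨-, h12, -⟩ :=
    stuck_inj (F := ⟨some 0, .hole⟩) (x := 2) (v := .var 3) trivial hw heq
  cases h12

theorem techniques_diff : techniques \ {utSubstC} = strongTechniques := by
  have hne : utSubstC ∉ strongTechniques := fun h =>
    not_stronglyEvolves_substC _ _ (stronglyEvolves_of_mem h)
  ext f
  constructor
  · rintro ⟨hf, hfc⟩
    simp only [techniques, strongTechniques, Set.mem_insert_iff,
      Set.mem_singleton_iff] at hf hfc ⊢
    tauto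
  · intro hf
    refine ⟨strongTechniques_subset hf, ?_⟩
    rintro rfl
    exact hne hf

/-! ### Congruence -/

theorem closedUnder_techniques_bisim : ClosedUnder techniques bisim :=
  isStrongPart_strongTechniques.closedUnder_bisim continuous_of_mem_techniques

theorem bisim_symm {p q : Prog} (h : (p, q) ∈ bisim) : (q, p) ∈ bisim :=
  subset_bisim (R := swapRel bisim) isBisim_bisim.swap h

theorem bisim_reds {p q p' : Prog} (h : (p, q) ∈ bisim) (hp : Reds p p') :
    ∃ q', Reds q q' ∧ (p', q') ∈ bisim := by
  induction hp with
  | refl => exact ⟨q, .refl, h⟩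
  | tail _ hr ih =>
    obtain ⟨q₁, hq₁, h₁⟩ := ih
    obtain ⟨q₂, hq₂, h₂⟩ := isBisim_bisim.red _ _ h₁ _ hr
    exact ⟨q₂, hq₁.trans hq₂, h₂⟩

/-- Composition of bisimilarity with itself. The tests of the two factors use unrelated fresh
variables; closure under the techniques brings them to common ones. -/
theorem bisim_trans {p q r : Prog} (hpq : (p, q) ∈ bisim) (hqr : (q, r) ∈ bisim) :
    (p, r) ∈ bisim := by
  let R : PRel := {pr | ∃ q, (pr.1, q) ∈ bisim ∧ (q, pr.2) ∈ bisim}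
  have hs := closedUnder_techniques_bisim.strong
  have hval : ∀ u v w : Tm, u.IsVal → v.IsVal → w.IsVal → TestVal bisim u v →
      TestVal bisim v w → TestVal R u w := fun u v w hu hv hw huv hvw =>
    testVal_of_forall Set.finite_empty Set.finite_empty fun c _ y _ =>
      ⟨_, hs.plug_app_mem hu hv huv ⟨some c, .hole⟩ (.var y),
        hs.plug_app_mem hv hw hvw ⟨some c, .hole⟩ (.var y)⟩
  have hctx : ∀ F G H : PCtx, TestCtx bisim F G → TestCtx bisim G H → TestCtx R F H :=
    fun F G H hFG hGH => testCtx_of_forall Set.finite_empty fun y _ =>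
      ⟨_, hs.plug_mem hFG (v := .var y) (w := .var y) trivial trivial (hs.testVal_refl _),
        hs.plug_mem hGH trivial trivial (hs.testVal_refl _)⟩
  have key : ∀ p r, (p, r) ∈ R → Matches R R p r := by
    rintro p r ⟨q, hpq, hqr⟩
    have hm : Matches bisim bisim p q := Progress.matches isBisim_bisim hpq
    cases hm with
    | red h hq ht =>
      obtain ⟨r', hr, h'⟩ := bisim_reds hqr hq
      exact .red h hr ⟨_, ht, h'⟩
    | val hv hw hq =>
      obtain ⟨r', hr, h'⟩ := bisim_reds hqr hq
      obtain ⟨u, hu, he⟩ := (Progress.matches isBisim_bisim h').val_left hw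
      exact .val hv hu (hr.trans he.1)
    | stuck hv hw hq hF hvw =>
      obtain ⟨r', hr, h'⟩ := bisim_reds hqr hq
      obtain ⟨G, u, hu, he, hG, hwu⟩ := (Progress.matches isBisim_bisim h').stuck_left hw
      exact .stuck hv hu (hr.trans he.1) (hctx _ _ _ hF hG) (hval _ _ _ hv hw hu hvw hwu)
    | ctxVal hv hw hq hvw =>
      obtain ⟨r', hr, h'⟩ := bisim_reds hqr hq
      obtain ⟨u, hu, he, hwu⟩ := (Progress.matches isBisim_bisim h').ctxVal_left hw
      exact .ctxVal hv hu (hr.trans he.1) (hval _ _ _ hv hw hu hvw hwu)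
  have hsymm : ∀ p r, (p, r) ∈ R → (r, p) ∈ R := fun p r ⟨q, h, h'⟩ =>
    ⟨q, bisim_symm h', bisim_symm h⟩
  have hR : IsBisim R := .of_matches subset_rfl subset_rfl key fun p r h =>
    (key r p (hsymm p r h)).mono (fun x hx => hsymm x.1 x.2 hx) (fun x hx => hsymm x.1 x.2 hx)
  exact subset_bisim hR ⟨q, hpq, hqr⟩

theorem TestTm.plug_mem {X : PRel} (hX : ClosedUnder techniques X) {t s : Tm}
    (h : TestTm X t s) {F F' : PCtx} (hF : TestCtx X F F') : (F.plug t, F'.plug s) ∈ X := by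
  obtain ⟨c, ht, hs, h⟩ := h
  have := substC_mem hX.substC_subset h hF c
  rwa [Prog.substc_inCtx_self, Prog.substc_inCtx_self, Tm.substc_of_notMem ht,
    Tm.substc_of_notMem hs] at this

theorem testTm_of_forall {X : PRel} {t s : Tm}
    (h : ∀ c, (Prog.inCtx c t, Prog.inCtx c s) ∈ X) : TestTm X t s := by
  obtain ⟨c, hc⟩ := (t.finite_fk.union s.finite_fk).exists_notMem
  exact ⟨c, fun h => hc (Or.inl h), fun h => hc (Or.inr h), h c⟩

theorem TestTm.plug_refl_mem {X : PRel} (hX : ClosedUnder techniques X) {t s : Tm}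
    (h : TestTm X t s) (F : PCtx) : (F.plug t, F.plug s) ∈ X :=
  h.plug_mem hX (hX.strong.testCtx_refl F)

theorem TestTm.plug {X : PRel} (hX : ClosedUnder techniques X) (C : TCtx) {t s : Tm}
    (h : TestTm X t s) : TestTm X (C.plug t) (C.plug s) := by
  induction C with
  | hole => exact h
  | lam x C ih =>
    exact testTm_of_forall fun c =>
      hX utLam (by simp [techniques]) ⟨c, x, _, _, ih, rfl⟩
  | appL C u ih =>
    exact testTm_of_forall fun c => ih.plug_refl_mem hX ⟨some c, .appL .hole u⟩
  | appR u C ih =>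
    -- As `u` need not be a value, `[] (C[t])` and `[] (C[s])` are first related as contexts.
    refine testTm_of_forall fun c => ?_
    have hF : TestCtx X ⟨some c, .appL .hole (C.plug t)⟩ ⟨some c, .appL .hole (C.plug s)⟩ :=
      testCtx_of_forall Set.finite_empty fun y _ =>
        ih.plug_refl_mem hX ⟨some c, .appR (.var y) trivial .hole⟩
    exact TestTm.plug_mem hX (testTm_of_forall fun d => hX.strong.refl_mem (.inCtx d u)) hF
  | abort k C ih =>
    exact testTm_of_forall fun c =>
      hX utAbort (by simp [techniques]) ⟨c, _, _, ih.plug_refl_mem hX ⟨k, .hole⟩, rfl⟩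

theorem isCongruence_bisim : IsCongruence (TestTm bisim) := by
  have hb := closedUnder_techniques_bisim
  refine ⟨⟨fun t => ?_, fun h => ?_, fun h h' => ?_⟩, fun C t s h => h.plug hb C⟩
  · exact testTm_of_forall fun c => hb.strong.refl_mem _
  · exact testTm_of_forall fun c => bisim_symm (h.plug_refl_mem hb ⟨some c, .hole⟩)
  · exact testTm_of_forall fun c => bisim_trans (h.plug_refl_mem hb ⟨some c, .hole⟩)
      (h'.plug_refl_mem hb ⟨some c, .hole⟩)

end CallccNF

theorem theoremt :
    CallccNF.DiacriticallyCompatible CallccNF.techniques ∧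
    IsGreatest {𝓢 | CallccNF.IsStrongPart CallccNF.techniques 𝓢}
      (CallccNF.techniques \ {CallccNF.utSubstC}) ∧
    CallccNF.IsCongruence (CallccNF.TestTm CallccNF.bisim) := by
  refine ⟨⟨CallccNF.continuous_of_mem_techniques, _, CallccNF.isStrongPart_strongTechniques⟩,
    ⟨?_, fun 𝓢 h𝓢 f hf => ⟨h𝓢.subset hf, ?_⟩⟩, CallccNF.isCongruence_bisim⟩
  · rw [CallccNF.techniques_diff]
    exact CallccNF.isStrongPart_strongTechniques
  · rintro rfl
    exact CallccNF.not_stronglyEvolves_substC _ _ (h𝓢.strong _ hf)
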